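/- Let $D$ be a division ring, let $F$ be a subfield of the center of $D$, and assume that $D$ has finite degree $d=[D:F]$ over $F$. Let $n\ge 2$ be an integer and let $S$ be an $F$-linear subspace of the matrix ring $\mathrm{Mat}_n(D)$ such that $\dim_F S=n+d\binom n2$ and every $M\in S$ is $F$-diagonalisable, i.e. $M=P\Delta P^{-1}$ for some $P\in\mathrm{GL}_n(D)$ and some diagonal matrix $\Delta$ with all diagonal entries in $F$. Then: 1. $F$ is formally real ($-1$ is not a sum of squares in $F$) and Pythagorean (for all $x,y\in F$ there is $z\in F$ with $x^2+y^2=z^2$); in particular $F$ has characteristic $0$. 2. $D$ is of quadratic type over $F$, meaning that one of the following holds: (i) $d=1$; (ii) $d=2$ and $D$ is a separable field extension of $F$; (iii) $d=4$ and $D$ is a quaternion algebra over $F$; (iv) $F$ has characteristic $2$, $d=2^m$ for some $m\ge1$, $D$ is commutative and $x^2\in F$ for all $x\in D$. Let $\sigma$ denote the standard involution of $D$ over $F$, which is uniquely determined: the identity in cases (i) and (iv), the non-identity $F$-automorphism of $D$ in case (ii), and the quaternionic conjugation in case (iii). 3. The standard norm $x\mapsto x\,\sigma(x)$ is square-valued: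 for every $x\in D$ there is $a\in F$ with $x\,\sigma(x)=a^2$. 4. $S$ is similar to the space of Hermitian matrices $\mathcal H_n(D)=\{M\in\mathrm{Mat}_n(D): \sigma(M)^T=M\}$ (with $\sigma$ applied entrywise), i.e. there is $P\in\mathrm{GL}_n(D)$ with $\mathcal H_n(D)=PSP^{-1}$. -/

import Mathlib

open scoped Quaternion

/-- A square matrix over `D` is `F`-diagonalisable when it is similar over `D` to a diagonal matrix
all of whose diagonal entries belong to (the image in `D` of) `F`. -/
def IsFDiagonalisable (F : Type*) {D : Type*} [Field F] [DivisionRing D] [Algebra F D] {n : ℕ}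
    (M : Matrix (Fin n) (Fin n) D) : Prop :=
  ∃ (P : (Matrix (Fin n) (Fin n) D)ˣ) (δ : Fin n → F),
    M = P.val * Matrix.diagonal (fun i => algebraMap F D (δ i)) * P⁻¹.val

/-- Two sets of square matrices over `D` are similar when `Y = P X P⁻¹` for some invertible `P`. -/
def AreSimilar {D : Type*} [DivisionRing D] {n : ℕ}
    (X Y : Set (Matrix (Fin n) (Fin n) D)) : Prop :=
  ∃ P : (Matrix (Fin n) (Fin n) D)ˣ, Y = (fun M => P.val * M * P⁻¹.val) '' X

/-- Every sum of two squares is a square. -/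
def IsPythagorean (F : Type*) [Field F] : Prop :=
  ∀ x y : F, ∃ z : F, x ^ 2 + y ^ 2 = z ^ 2

/-- `D` is a separable quadratic field extension of `F`. -/
def IsSeparableQuadratic (F D : Type*) [Field F] [DivisionRing D] [Algebra F D] : Prop :=
  Module.finrank F D = 2 ∧ (∀ x y : D, x * y = y * x) ∧ Algebra.IsSeparable F D

/-- The division ring `D` is a quaternion algebra over `F`: it is central of dimension `4`
(a division ring is simple). -/
def IsQuaternionDivisionAlgebra (F D : Type*) [Field F] [DivisionRing D] [Algebra F D] : Prop :=
  Module.finrank F D = 4 ∧ Algebra.IsCentral F D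

/-- `D` is a hyper-radicial extension of `F`, of degree `2 ^ m` with `m ≥ 1`,
the characteristic being `2`. -/
def IsHyperRadicial (F D : Type*) [Field F] [DivisionRing D] [Algebra F D] : Prop :=
  (∃ m : ℕ, 1 ≤ m ∧ Module.finrank F D = 2 ^ m) ∧ CharP F 2 ∧ (∀ x y : D, x * y = y * x) ∧
    ∀ x : D, ∃ a : F, x ^ 2 = algebraMap F D a

/-- `D` is of quadratic type over `F`. -/
def IsOfQuadraticType (F D : Type*) [Field F] [DivisionRing D] [Algebra F D] : Prop :=
  Module.finrank F D = 1 ∨ IsSeparableQuadratic F D ∨ IsQuaternionDivisionAlgebra F D ∨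
    IsHyperRadicial F D

/-- `σ` is the quaternionic conjugation of the quaternion algebra `D`: it corresponds to the
conjugation of `ℍ[F, a, b, c]` (generated by `i`, `j` with `i² = a + b i`, `j² = c` and
`j i = b j - i j`) under an isomorphism of `F`-algebras. -/
def IsQuaternionConj (F : Type*) {D : Type*} [Field F] [DivisionRing D] [Algebra F D]
    (σ : D → D) : Prop :=
  ∃ (a b c : F) (φ : D ≃ₐ[F] ℍ[F, a, b, c]), ∀ x : D, φ (σ x) = star (φ x)

/-- `σ` is the standard involution of the division ring `D` of quadratic type over `F`: the identity
if `D` has degree `1` or is hyper-radicial, the non-identity automorphism over `F` if `D` is a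
separable quadratic extension, the quaternionic conjugation if `D` is a quaternion algebra. -/
def IsStandardInvolution (F : Type*) {D : Type*} [Field F] [DivisionRing D] [Algebra F D]
    (σ : D → D) : Prop :=
  (Module.finrank F D = 1 ∧ ∀ x, σ x = x) ∨
  (IsSeparableQuadratic F D ∧ ∃ τ : D ≃ₐ[F] D, τ ≠ AlgEquiv.refl ∧ ∀ x, σ x = τ x) ∨
  (IsQuaternionDivisionAlgebra F D ∧ IsQuaternionConj F σ) ∨
  (IsHyperRadicial F D ∧ ∀ x, σ x = x)

/-- The standard norm `x ↦ x σ(x)` takes its values in the set of squares of `F`. -/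
def IsNormSquareValued (F : Type*) {D : Type*} [Field F] [DivisionRing D] [Algebra F D]
    (σ : D → D) : Prop :=
  ∀ x : D, ∃ a : F, x * σ x = algebraMap F D (a ^ 2)

/-- The set of Hermitian matrices `M`, i.e. with `σ(M)ᵀ = M`. -/
def hermitianMatrices {D : Type*} (n : ℕ) (σ : D → D) : Set (Matrix (Fin n) (Fin n) D) :=
  {M | (M.map σ).transpose = M}

section

variable {F D : Type*} [Field F] [DivisionRing D] [Algebra F D] {n : ℕ}

/-! Order the basis in any way. An `F`-diagonalisable matrix that is upper triangular for this order
has its diagonal in `F`, and it vanishes if that diagonal is zero. So a matrix of `S` is determined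
by its strictly lower entries, each in `D`, and an `F`-component of each diagonal entry. The
dimension of `S` equals the number of these parameters, so every choice of them occurs
(`IsExtremal.exists_mem`), and this for every order.

Prescribing zero lower part and a unit vector as diagonal yields `n` orthogonal idempotents, so up
to conjugation `S` contains all `E_ii` (`exists_conj_single_mem`). Prescribing a single lower entry
`a` in an order starting with `i, j` yields a matrix whose `(i, j)` corner has distinct eigenvalues
in `F`. Adding `s E_ii` to it forces a zero diagonal, `a * M i j = c²` with `c ≠ 0`, and `s² + 4c²`
a nonzero square for every `s`; this makes `F` Pythagorean and formally real. The rest of the matrix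
then vanishes (`eq_offDiagonal_of_corner`), so `S` contains `a E_ji + f E_ij`.

A diagonal conjugation and an argument on three indices (`ratio_eq_one`) allow `f = 1` whenever `a =
1`. Then `a ↦ f` has trace and norm in `F`; there is only one such map on `D`, so all pairs `(i, j)`
share one `σ`, and `S` is the space of Hermitian matrices for `σ`.

Finally, every non-scalar element of `D` is `s + c y` with `y² = -1`. The centraliser of such a `y`
is `F + F y`, which leaves only `F`, a quadratic extension, or the quaternions over `F`. -/

/-! ### Eigenvectors of diagonalisable and triangular matrices. -/

/-- The action of a matrix on column vectors, as an `F`-linear map. -/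
def mulVecF (F : Type*) {D : Type*} [Field F] [DivisionRing D] [Algebra F D] {n : ℕ}
    (M : Matrix (Fin n) (Fin n) D) : Module.End F (Fin n → D) where
  toFun v := M.mulVec v
  map_add' := M.mulVec_add
  map_smul' c v := M.mulVec_smul c v

@[simp] theorem mulVecF_apply (M : Matrix (Fin n) (Fin n) D) (v : Fin n → D) :
    mulVecF F M v = M.mulVec v := rfl

theorem IsFDiagonalisable.iSup_eigenspace {M : Matrix (Fin n) (Fin n) D}
    (hM : IsFDiagonalisable F M) : ⨆ μ, (mulVecF F M).eigenspace μ = ⊤ := by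
  obtain ⟨P, δ, rfl⟩ := hM
  refine eq_top_iff.2 fun v _ => ?_
  have hv : v = ∑ i, P.val.mulVec (Pi.single i ((P⁻¹.val.mulVec v) i)) := by
    rw [← Matrix.mulVec_sum, Finset.univ_sum_single, Matrix.mulVec_mulVec, Units.mul_inv,
      Matrix.one_mulVec]
  rw [hv]
  refine Submodule.sum_mem _ fun i _ => Submodule.mem_iSup_of_mem (δ i) ?_
  rw [Module.End.mem_eigenspace_iff]
  rw [mulVecF_apply, Matrix.mulVec_mulVec, mul_assoc, Units.inv_mul, mul_one,
    ← Matrix.mulVec_mulVec, ← Matrix.mulVec_smul]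
  congr 1
  ext k
  rw [Matrix.mulVec_diagonal]
  by_cases h : k = i
  · subst h; simp [Algebra.smul_def]
  · simp [h]

/-- An invariant subspace of a diagonalisable matrix is generated by its eigenvectors. -/
theorem IsFDiagonalisable.exists_eigenvector [FiniteDimensional F D]
    {M : Matrix (Fin n) (Fin n) D}
    (hM : IsFDiagonalisable F M) {W W' : Submodule F (Fin n → D)}
    (hW : ∀ v ∈ W, M.mulVec v ∈ W) (h : ¬ W ≤ W') :
    ∃ (μ : F) (v : Fin n → D), v ∈ W ∧ v ∉ W' ∧ M.mulVec v = μ • v := by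
  by_contra! hc
  apply h
  have := Submodule.inf_iSup_genEigenspace (p := W) (f := mulVecF F M) hW 1
  have h2 : ⨆ μ, (mulVecF F M).genEigenspace μ 1 = ⊤ := hM.iSup_eigenspace
  rw [h2, inf_top_eq] at this
  rw [this]
  refine iSup_le fun μ v hv => ?_
  by_contra hv'
  exact hc μ v hv.1 hv' (Module.End.mem_eigenspace_iff.1 hv.2)

/-- A matrix that kills all eigenvectors of a diagonalisable matrix is zero. -/
theorem IsFDiagonalisable.eq_zero_of_forall_eigenvector [FiniteDimensional F D]
    {M : Matrix (Fin n) (Fin n) D}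
    (hM : IsFDiagonalisable F M) (Q : Matrix (Fin n) (Fin n) D)
    (h : ∀ (μ : F) (v : Fin n → D), v ≠ 0 → M.mulVec v = μ • v → Q.mulVec v = 0) : Q = 0 := by
  have key : (⊤ : Submodule F (Fin n → D)) ≤ LinearMap.ker (mulVecF F Q) := by
    by_contra hc
    obtain ⟨μ, v, -, hv, hMv⟩ := hM.exists_eigenvector (fun _ _ => Submodule.mem_top) hc
    refine hv (h μ v ?_ hMv)
    rintro rfl
    exact hv (Submodule.zero_mem _)
  ext i j
  have := congrFun (LinearMap.mem_ker.1 (key (Submodule.mem_top (x := Pi.single j 1)))) i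
  simpa using this

theorem IsFDiagonalisable.conj {M : Matrix (Fin n) (Fin n) D} (hM : IsFDiagonalisable F M)
    (Q : (Matrix (Fin n) (Fin n) D)ˣ) : IsFDiagonalisable F (Q.val * M * Q⁻¹.val) := by
  obtain ⟨P, δ, rfl⟩ := hM
  exact ⟨Q * P, δ, by simp [mul_assoc]⟩

/-- The top nonzero coordinate of an eigenvector computes the eigenvalue as a diagonal entry, if
the row of that coordinate is upper triangular. -/
theorem eigenvalue_eq_of_top {M : Matrix (Fin n) (Fin n) D} (r : Equiv.Perm (Fin n)) {i : Fin n}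
    {v : Fin n → D} {μ : F} (hv : M.mulVec v = μ • v) (hi : v i ≠ 0)
    (htop : ∀ k, r i < r k → v k = 0) (hM : ∀ l, r l < r i → M i l = 0) :
    M i i = algebraMap F D μ := by
  have h := congrFun hv i
  rw [Matrix.mulVec, dotProduct, Finset.sum_eq_single i, Pi.smul_apply, Algebra.smul_def] at h
  · exact mul_right_cancel₀ hi h
  · intro k _ hk
    rcases lt_trichotomy (r k) (r i) with h' | h' | h'
    · rw [hM k h', zero_mul]
    · exact absurd (r.injective h') hk
    · rw [htop k h', mul_zero]
  · simp

theorem exists_top (r : Equiv.Perm (Fin n)) {v : Fin n → D} (hv : v ≠ 0) :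
    ∃ i, v i ≠ 0 ∧ ∀ k, r i < r k → v k = 0 := by
  classical
  obtain ⟨j, hj⟩ := Function.ne_iff.1 hv
  obtain ⟨i, hi, hmax⟩ := Finset.exists_max_image (Finset.univ.filter fun i => v i ≠ 0) r
    ⟨j, by simpa using hj⟩
  refine ⟨i, by simpa using hi, fun k hk => ?_⟩
  by_contra hne
  exact absurd (hmax k (by simpa using hne)) (not_le.2 hk)

/-- The vectors supported on positions up to `i` form an invariant subspace, which is spanned by
eigenvectors. One of these has a nonzero `i`-th coordinate, and its eigenvalue is the diagonal
entry. -/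
theorem IsFDiagonalisable.diag_mem_range [FiniteDimensional F D] {M : Matrix (Fin n) (Fin n) D}
    (hM : IsFDiagonalisable F M) (r : Equiv.Perm (Fin n)) (i : Fin n)
    (h1 : ∀ k l, r l ≤ r i → r i < r k → M k l = 0) (h2 : ∀ l, r l < r i → M i l = 0) :
    ∃ μ : F, M i i = algebraMap F D μ := by
  let W : Submodule F (Fin n → D) :=
    { carrier := {v | ∀ k, r i < r k → v k = 0}
      add_mem' := fun ha hb k hk => by simp [ha k hk, hb k hk]
      zero_mem' := fun _ _ => rfl
      smul_mem' := fun c v hv k hk => by simp [hv k hk] }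
  have hW : ∀ v ∈ W, M.mulVec v ∈ W := fun v hv k hk => by
    rw [Matrix.mulVec, dotProduct]
    refine Finset.sum_eq_zero fun l _ => ?_
    rcases le_or_gt (r l) (r i) with h | h
    · rw [h1 k l h hk, zero_mul]
    · rw [hv l h, mul_zero]
  have hne : ¬ W ≤ LinearMap.ker (LinearMap.proj (R := F) (φ := fun _ : Fin n => D) i) := by
    intro hle
    have : (Pi.single i 1 : Fin n → D) ∈ W := fun k hk => by
      rw [Pi.single_eq_of_ne]; rintro rfl; exact lt_irrefl _ hk
    have := hle this
    simp at this
  obtain ⟨μ, v, hvW, hv, hMv⟩ := hM.exists_eigenvector hW hne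
  exact ⟨μ, eigenvalue_eq_of_top r hMv (by simpa using hv) hvW h2⟩

theorem IsFDiagonalisable.eq_zero_of_strictUpper [FiniteDimensional F D]
    {M : Matrix (Fin n) (Fin n) D}
    (hM : IsFDiagonalisable F M) (r : Equiv.Perm (Fin n))
    (h : ∀ k l, r l ≤ r k → M k l = 0) : M = 0 := by
  refine hM.eq_zero_of_forall_eigenvector M fun μ v hv hMv => ?_
  obtain ⟨i, hi, htop⟩ := exists_top r hv
  have := eigenvalue_eq_of_top r hMv hi htop fun l hl => h i l hl.le
  rw [h i i le_rfl] at this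
  have hμ : μ = 0 := (FaithfulSMul.algebraMap_eq_zero_iff F D).1 this.symm
  rw [hMv, hμ, zero_smul]

/-! ### Extremal spaces parametrised by lower triangular data. -/

/-- The number of pairs of positions in descending order. -/
theorem card_lower (r : Equiv.Perm (Fin n)) :
    Fintype.card {p : Fin n × Fin n // r p.2 < r p.1} = n.choose 2 := by
  rw [Fintype.card_congr ((r.prodCongr r).subtypeEquiv (q := fun p => p.2 < p.1)
      (fun p => by simp)), Fintype.card_subtype, Finset.card_filter,
    ← Finset.univ_product_univ, Finset.sum_product]
  simp only [← Finset.card_filter, show ∀ x : Fin n, (Finset.univ.filter fun i => i < x).card = (x : ℕ) from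
    fun x => by rw [← Fin.card_Iio x]; congr 1; ext; simp]
  rw [Fin.sum_univ_eq_sum_range (fun i => i), Finset.sum_range_id, Nat.choose_two_right]

/-- A linear space of `F`-diagonalisable matrices with the greatest possible dimension. -/
structure IsExtremal (S : Submodule F (Matrix (Fin n) (Fin n) D)) : Prop where
  diag : ∀ M ∈ S, IsFDiagonalisable F M
  finrank_eq : Module.finrank F S = n + Module.finrank F D * n.choose 2

/-- The strictly lower entries and the diagonal entries modulo a complement of `F`. -/
def lowerData (φ : D →ₗ[F] F) (r : Equiv.Perm (Fin n)) :
    Matrix (Fin n) (Fin n) D →ₗ[F]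
      (Fin n → F) × ({p : Fin n × Fin n // r p.2 < r p.1} → D) where
  toFun M := (fun i => φ (M i i), fun p => M p.1.1 p.1.2)
  map_add' _ _ := by ext <;> simp
  map_smul' _ _ := by ext <;> simp

/-- Diagonal entries lie a priori in `D`, while the dimension leaves room for only one copy of `F`
at each; `φ` selects that copy. -/
theorem exists_retraction (F D : Type*) [Field F] [DivisionRing D] [Algebra F D] :
    ∃ φ : D →ₗ[F] F, ∀ x : F, φ (algebraMap F D x) = x := by
  obtain ⟨φ, hφ⟩ := (Algebra.linearMap F D).exists_leftInverse_of_injective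
    (LinearMap.ker_eq_bot.2 (algebraMap F D).injective)
  exact ⟨φ, fun x => LinearMap.congr_fun hφ x⟩

/-- Conjugation by an invertible matrix. -/
def conjLinear (F : Type*) {D : Type*} [Field F] [DivisionRing D] [Algebra F D] {n : ℕ}
    (P : (Matrix (Fin n) (Fin n) D)ˣ) :
    Matrix (Fin n) (Fin n) D ≃ₗ[F] Matrix (Fin n) (Fin n) D where
  toFun M := P.val * M * P⁻¹.val
  map_add' _ _ := by rw [mul_add, add_mul]
  map_smul' _ _ := by simp
  invFun M := P⁻¹.val * M * P.val
  left_inv _ := by simp [mul_assoc]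
  right_inv _ := by simp [mul_assoc]

theorem IsExtremal.conj {S : Submodule F (Matrix (Fin n) (Fin n) D)}
    (hS : IsExtremal S) (P : (Matrix (Fin n) (Fin n) D)ˣ) :
    IsExtremal (S.map (conjLinear F P).toLinearMap) where
  diag := by
    rintro _ ⟨M, hM, rfl⟩
    exact (hS.diag M hM).conj P
  finrank_eq := by
    rw [← hS.finrank_eq]
    exact LinearEquiv.finrank_map_eq _ _

/-- A nonzero `A v` is an eigenvector for the eigenvalue `1`, which would have to be a diagonal
entry. The centre of `D` serves as the field of scalars. -/
theorem eq_zero_of_idempotent_strictUpper {A : Matrix (Fin n) (Fin n) D} (hA : A * A = A)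
    (h : ∀ i j, j ≤ i → A i j = 0) : A = 0 := by
  have key : ∀ v : Fin n → D, A.mulVec v = 0 := fun v => by
    by_contra hne
    obtain ⟨i, hi, htop⟩ := exists_top 1 hne
    have := eigenvalue_eq_of_top (M := A) (μ := (1 : Subring.center D)) 1
      (by rw [Matrix.mulVec_mulVec, hA, one_smul]) hi htop fun l hl => h i l (le_of_lt hl)
    simp [h i i le_rfl] at this
  ext i j
  simpa using congrFun (key (Pi.single j 1)) i

namespace IsExtremal

variable [FiniteDimensional F D] {S : Submodule F (Matrix (Fin n) (Fin n) D)}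

/-- The data map is injective on `S`, since a matrix in its kernel is strictly upper triangular and
diagonalisable; equal dimensions make it surjective. -/
theorem exists_mem (hS : IsExtremal S) (r : Equiv.Perm (Fin n)) {φ : D →ₗ[F] F}
    (hφ : ∀ x : F, φ (algebraMap F D x) = x) (L : Fin n → Fin n → D) (δ : Fin n → F) :
    ∃ M ∈ S, (∀ i j, r j < r i → M i j = L i j) ∧ ∀ i, φ (M i i) = δ i := by
  have hinj : Function.Injective ((lowerData φ r).comp S.subtype) := by
    rw [injective_iff_map_eq_zero]
    rintro ⟨M, hM⟩ h
    have hlow : ∀ i j, r j < r i → M i j = 0 := fun i j hij =>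
      congrFun (congrArg Prod.snd h) ⟨(i, j), hij⟩
    have hdiag : ∀ i, φ (M i i) = 0 := fun i => congrFun (congrArg Prod.fst h) i
    have := (hS.diag M hM).eq_zero_of_strictUpper r fun k l hkl => by
      rcases hkl.lt_or_eq with h' | h'
      · exact hlow k l h'
      · obtain rfl := r.injective h'
        obtain ⟨μ, hμ⟩ := (hS.diag M hM).diag_mem_range r l
          (fun i j h1 h2 => hlow i j (h1.trans_lt h2)) (fun j hj => hlow l j hj)
        have h3 := hdiag l
        rw [hμ, hφ] at h3
        rw [hμ, h3, map_zero]
    exact Subtype.ext this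
  have hrank : Module.finrank F S = Module.finrank F
      ((Fin n → F) × ({p : Fin n × Fin n // r p.2 < r p.1} → D)) := by
    rw [hS.finrank_eq, Module.finrank_prod, Module.finrank_pi, Module.finrank_pi_fintype]
    simp [card_lower, mul_comm]
  obtain ⟨⟨M, hM⟩, h⟩ := (LinearMap.injective_iff_surjective_of_finrank_eq_finrank hrank).1 hinj
    (δ, fun p => L p.1.1 p.1.2)
  exact ⟨M, hM, fun i j hij => congrFun (congrArg Prod.snd h) ⟨(i, j), hij⟩,
    fun i => congrFun (congrArg Prod.fst h) i⟩

/-! ### Orthogonal idempotents in an extremal space. -/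

theorem exists_upper (hS : IsExtremal S) (δ : Fin n → F) :
    ∃ M ∈ S, (∀ i j, j < i → M i j = 0) ∧ ∀ i, M i i = algebraMap F D (δ i) := by
  obtain ⟨φ, hφ⟩ := exists_retraction F D
  obtain ⟨M, hM, h1, h2⟩ := hS.exists_mem 1 hφ 0 δ
  refine ⟨M, hM, h1, fun i => ?_⟩
  obtain ⟨μ, hμ⟩ := (hS.diag M hM).diag_mem_range 1 i
    (fun i j h3 h4 => h1 i j (h3.trans_lt h4)) (fun j hj => h1 i j hj)
  have h3 := h2 i
  rw [hμ, hφ] at h3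
  rw [hμ, h3]

/-- All eigenvalues are diagonal entries, hence `0` or `1`, so `M² - M` kills every eigenvector. -/
theorem isIdempotentElem_of_upper (hS : IsExtremal S) {M : Matrix (Fin n) (Fin n) D} (hM : M ∈ S)
    (h : ∀ i j, j < i → M i j = 0) (hd : ∀ i, M i i = 0 ∨ M i i = 1) : M * M = M := by
  rw [← sub_eq_zero]
  refine (hS.diag M hM).eq_zero_of_forall_eigenvector _ fun μ v hv hMv => ?_
  obtain ⟨i, hi, htop⟩ := exists_top 1 hv
  have h1 := eigenvalue_eq_of_top 1 hMv hi htop fun l hl => h i l hl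
  have hμ : μ * μ = μ := (algebraMap F D).injective <| by
    rw [map_mul, ← h1]
    rcases hd i with h2 | h2 <;> simp [h2]
  rw [Matrix.sub_mulVec, ← Matrix.mulVec_mulVec, hMv, Matrix.mulVec_smul, hMv, smul_smul, hμ,
    sub_self]

theorem _root_.isUnit_of_unitriangular (F : Type*) {D : Type*} [Field F] [DivisionRing D]
    [Algebra F D] [FiniteDimensional F D] {n : ℕ} {Q : Matrix (Fin n) (Fin n) D}
    (h : ∀ i j, j < i → Q i j = 0) (hd : ∀ i, Q i i = 1) : IsUnit Q := by
  have hinj : Function.Injective (mulVecF F Q) := by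
    rw [injective_iff_map_eq_zero]
    intro v hv
    by_contra hne
    obtain ⟨i, hi, htop⟩ := exists_top 1 hne
    have := eigenvalue_eq_of_top (μ := (0 : F)) 1 (by simpa using hv) hi htop
      fun l hl => h i l hl
    simp [hd] at this
  have hsurj := LinearMap.injective_iff_surjective.1 hinj
  choose B hB using fun j : Fin n => hsurj (Pi.single j 1)
  have hright : Q * (Matrix.of fun i j => B j i) = 1 := by
    ext i j
    have := congrFun (hB j) i
    rw [mulVecF_apply, Matrix.mulVec, dotProduct] at this
    rw [Matrix.mul_apply, Matrix.one_apply]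
    simpa [Pi.single_apply] using this
  refine ⟨⟨Q, _, hright, ?_⟩, rfl⟩
  ext i j
  have : ∀ v : Fin n → D, ((Matrix.of fun i j => B j i) * Q).mulVec v = v := fun v => hinj (by
    rw [mulVecF_apply, mulVecF_apply, Matrix.mulVec_mulVec, ← mul_assoc, hright, one_mul])
  simpa [Matrix.one_apply, Pi.single_apply] using congrFun (this (Pi.single j 1)) i

theorem exists_conj_single_mem (hS : IsExtremal S) : ∃ P : (Matrix (Fin n) (Fin n) D)ˣ,
    ∀ i, Matrix.single i i 1 ∈ S.map (conjLinear F P).toLinearMap := by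
  choose M hM hlow hdiag using fun i : Fin n => hS.exists_upper (Pi.single i (1 : F))
  have hself : ∀ i, M i i i = 1 := fun i => by simp [hdiag]
  have hother : ∀ i j, j ≠ i → M i j j = 0 := fun i j h => by simp [hdiag, h]
  have hidem : ∀ i, M i * M i = M i := fun i =>
    hS.isIdempotentElem_of_upper (hM i) (hlow i) fun j => by
      by_cases h : j = i
      · subst h; exact .inr (hself j)
      · exact .inl (hother i j h)
  have horth : ∀ i j, i ≠ j → M i * M j = 0 := fun i j hij => by
    have h1 : (M i + M j) * (M i + M j) = M i + M j :=
      hS.isIdempotentElem_of_upper (S.add_mem (hM i) (hM j))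
        (fun k l h => by simp [hlow i k l h, hlow j k l h]) fun k => by
        by_cases h : k = i
        · subst h; right; simp [hself, hother j k hij]
        · by_cases h' : k = j
          · subst h'; right; simp [hself, hother i k hij.symm]
          · left; simp [hother i k h, hother j k h']
    -- Two idempotents with idempotent sum anticommute; multiplying by `M i` on either side shows
    -- that they also commute, so their product is idempotent.
    have h2 : M i * M j = - (M j * M i) := by
      have : M i * M i + M i * M j + (M j * M i + M j * M j) = M i + M j := by
        rw [← h1]; noncomm_ring
      rw [hidem, hidem] at this
      rw [eq_neg_iff_add_eq_zero]
      calc M i * M j + M j * M i = (M i + M i * M j + (M j * M i + M j)) - (M i + M j) := by abel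
        _ = 0 := by rw [this, sub_self]
    have h3 : M i * M j = M j * M i := by
      have e1 : M i * M j = - (M i * M j * M i) := by
        calc M i * M j = M i * (M i * M j) := by rw [← mul_assoc, hidem]
          _ = - (M i * M j * M i) := by rw [h2, mul_neg, ← mul_assoc, h2]; 
      have e2 : M j * M i = - (M i * M j * M i) := by
        calc M j * M i = M j * M i * M i := by rw [mul_assoc, hidem]
          _ = - (M i * M j * M i) := by rw [h2]; simp
      rw [e1, e2]
    have h4 : (M i * M j) * (M i * M j) = M i * M j := by
      calc M i * M j * (M i * M j) = M i * (M j * M i) * M j := by noncomm_ring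
        _ = M i * M j := by rw [← h3, ← mul_assoc, hidem, mul_assoc, hidem]
    refine eq_zero_of_idempotent_strictUpper h4 fun k l hlk => ?_
    rw [Matrix.mul_apply]
    refine Finset.sum_eq_zero fun m _ => ?_
    rcases lt_or_ge m k with hm | hm
    · rw [hlow i k m hm, zero_mul]
    rcases lt_or_ge l m with hm' | hm'
    · rw [hlow j m l hm', mul_zero]
    obtain rfl : m = k := le_antisymm (hm'.trans hlk) hm
    obtain rfl : m = l := le_antisymm hm' hlk
    by_cases hmi : m = i
    · rw [hother j m (hmi ▸ hij), mul_zero]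
    · rw [hother i m hmi, zero_mul]
  -- Column `l` of `Q` is column `l` of `M l`, a vector fixed by `M l` and killed by the other
  -- idempotents.
  obtain ⟨Q, hQ⟩ := isUnit_of_unitriangular F (Q := Matrix.of fun k l => M l k l)
    (fun k l h => hlow l k l h) hself
  refine ⟨Q⁻¹, fun i => ⟨M i, hM i, ?_⟩⟩
  have hcomm : M i * Q.val = Q.val * Matrix.single i i 1 := by
    ext k l
    have e : (M i * Q.val) k l = (M i * M l) k l := by
      rw [hQ, Matrix.mul_apply, Matrix.mul_apply]; rfl
    rw [e]
    by_cases h : i = l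
    · subst h; rw [hidem, hQ]; simp
    · rw [horth i l h, Matrix.mul_single_apply_of_ne _ _ _ _ _ (Ne.symm h)]; rfl
  change Q⁻¹.val * M i * Q.val = _
  rw [mul_assoc, hcomm, ← mul_assoc, Units.inv_mul, one_mul]

end IsExtremal

/-! ### Two by two corners. -/

theorem exists_perm_first_second {i j : Fin n} (hij : i ≠ j) : ∃ r : Equiv.Perm (Fin n),
    (∀ k, k ≠ i → r i < r k) ∧ ∀ k, k ≠ i → k ≠ j → r j < r k := by
  have hn : 2 ≤ n := by
    by_contra h
    have : n ≤ 1 := by omega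
    exact hij (Fin.ext (by omega))
  let z : Fin n := ⟨0, by omega⟩
  let o : Fin n := ⟨1, by omega⟩
  have hzo : z ≠ o := by simp [z, o, Fin.ext_iff]
  let r1 := Equiv.swap i z
  let r := r1.trans (Equiv.swap (r1 j) o)
  have h1 : r1 i = z := Equiv.swap_apply_left _ _
  have h2 : r1 j ≠ z := fun h => hij (r1.injective (h1.trans h.symm))
  have hi : r i = z := by
    simp only [r, Equiv.trans_apply, h1]
    exact Equiv.swap_apply_of_ne_of_ne h2.symm hzo
  have hj : r j = o := by
    simp only [r, Equiv.trans_apply]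
    exact Equiv.swap_apply_left _ _
  have hz : ∀ k, k ≠ i → (r k : ℕ) ≠ 0 := fun k hk h =>
    hk (r.injective (hi ▸ Fin.ext h))
  have ho : ∀ k, k ≠ j → (r k : ℕ) ≠ 1 := fun k hk h =>
    hk (r.injective (hj ▸ Fin.ext h))
  refine ⟨r, fun k hk => ?_, fun k hk hk' => ?_⟩
  · rw [hi, Fin.lt_def]; exact Nat.pos_of_ne_zero (hz k hk)
  · rw [hj, Fin.lt_def]
    have := hz k hk
    have := ho k hk'
    change 1 < (r k : ℕ)
    omega

/-- The quadratic equation satisfied by the eigenvalues of a two by two corner. -/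
theorem corner_quadratic {M : Matrix (Fin n) (Fin n) D} {i j : Fin n} (hij : i ≠ j)
    (ha : M j i ≠ 0) {v : Fin n → D} {μ : F} (hv : v ≠ 0) (hsupp : ∀ k, k ≠ i → k ≠ j → v k = 0)
    (hMv : M.mulVec v = μ • v) :
    (M j i * M i i * (M j i)⁻¹ + M j j) * algebraMap F D μ =
      algebraMap F D μ * algebraMap F D μ +
        (M j i * M i i * (M j i)⁻¹ * M j j - M j i * M i j) := by
  have row : ∀ k, M k i * v i + M k j * v j = algebraMap F D μ * v k := fun k => by
    rw [← Algebra.smul_def, ← Pi.smul_apply, ← hMv, Matrix.mulVec, dotProduct,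
      ← Finset.sum_subset (Finset.subset_univ {i, j}), Finset.sum_pair hij]
    intro l _ hl
    simp only [Finset.mem_insert, Finset.mem_singleton, not_or] at hl
    rw [hsupp l hl.1 hl.2, mul_zero]
  set m := algebraMap F D μ with hm
  have hcomm : ∀ x : D, m * x = x * m := fun x => Algebra.commutes μ x
  -- Row `j` expresses `v i` through `v j`, so `v j ≠ 0`; substituting in row `i` and cancelling `v
  -- j` gives the equation. Conjugating by `M j i` and the centrality of `μ` replace commutativity.
  have hx : v i = (M j i)⁻¹ * ((m - M j j) * v j) := by
    rw [eq_inv_mul_iff_mul_eq₀ ha, sub_mul, ← row j, add_sub_cancel_right]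
  have hy : v j ≠ 0 := fun hy => hv <| by
    have hx0 : v i = 0 := by rw [hx, hy, mul_zero, mul_zero]
    ext k
    by_cases h1 : k = i
    · rw [h1, hx0]; rfl
    by_cases h2 : k = j
    · rw [h2, hy]; rfl
    exact hsupp k h1 h2
  have h1 : M j i * (M i i * v i + M i j * v j) = M j i * (m * v i) := by rw [row i]
  rw [hx] at h1
  apply mul_right_cancel₀ hy
  have e1 : M j i * (m * ((M j i)⁻¹ * ((m - M j j) * v j))) = m * ((m - M j j) * v j) := by
    rw [← mul_assoc, ← hcomm, mul_assoc, mul_inv_cancel_left₀ ha]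
  rw [e1] at h1
  have h2 : M j j * m = m * M j j := (hcomm _).symm
  have e2 : (M j i * M i i * (M j i)⁻¹ + M j j) * m * v j =
      M j i * (M i i * ((M j i)⁻¹ * ((m - M j j) * v j)) + M i j * v j)
       + M j i * M i i * (M j i)⁻¹ * M j j * v j - M j i * M i j * v j + M j j * m * v j := by
    noncomm_ring
  rw [e2, h1, h2]
  noncomm_ring

theorem IsFDiagonalisable.exists_corner_eigenvalues [FiniteDimensional F D]
    {M : Matrix (Fin n) (Fin n) D} (hM : IsFDiagonalisable F M) {i j : Fin n} (hij : i ≠ j)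
    (ha : M j i ≠ 0) (hinv : ∀ k, k ≠ i → k ≠ j → M k i = 0 ∧ M k j = 0) :
    ∃ l m : F, l ≠ m ∧ M j i * M i i * (M j i)⁻¹ + M j j = algebraMap F D (l + m) ∧
      M j i * M i i * (M j i)⁻¹ * M j j - M j i * M i j = algebraMap F D (l * m) := by
  let W : Submodule F (Fin n → D) :=
    { carrier := {v | ∀ k, k ≠ i → k ≠ j → v k = 0}
      add_mem' := fun ha hb k hk hk' => by simp [ha k hk hk', hb k hk hk']
      zero_mem' := fun _ _ _ => rfl
      smul_mem' := fun c v hv k hk hk' => by simp [hv k hk hk'] }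
  have hW : ∀ v ∈ W, M.mulVec v ∈ W := fun v hv k hk hk' => by
    rw [Matrix.mulVec, dotProduct]
    refine Finset.sum_eq_zero fun l _ => ?_
    by_cases h1 : l = i
    · rw [h1, (hinv k hk hk').1, zero_mul]
    by_cases h2 : l = j
    · rw [h2, (hinv k hk hk').2, zero_mul]
    rw [hv l h1 h2, mul_zero]
  have hi : (Pi.single i 1 : Fin n → D) ∈ W := fun k hk _ => Pi.single_eq_of_ne hk _
  have hne : ¬ W ≤ ⊥ := fun h => by
    have := congrFun ((Submodule.mem_bot F).1 (h hi)) i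
    simp at this
  obtain ⟨l, v, hvW, hv, hMv⟩ := hM.exists_eigenvector hW hne
  -- A second eigenvalue exists because `M j i ≠ 0` keeps the basis vector at `i` from being an
  -- eigenvector.
  have hne' : ¬ W ≤ (mulVecF F M).eigenspace l := fun h => by
    have := congrFun (Module.End.mem_eigenspace_iff.1 (h hi)) j
    rw [mulVecF_apply, Pi.smul_apply, Pi.single_eq_of_ne hij.symm] at this
    simp at this
    exact ha this
  obtain ⟨m, w, hwW, hw, hMw⟩ := hM.exists_eigenvector hW hne'
  have hlm : l ≠ m := by
    rintro rfl
    exact hw (Module.End.mem_eigenspace_iff.2 hMw)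
  have hl := corner_quadratic hij ha (by simpa using hv) hvW hMv
  have hm := corner_quadratic hij ha
    (by rintro rfl; exact hw (Submodule.zero_mem _)) hwW hMw
  set p := M j i * M i i * (M j i)⁻¹ + M j j
  set q := M j i * M i i * (M j i)⁻¹ * M j j - M j i * M i j
  have hp : p = algebraMap F D (l + m) := by
    -- Subtracting the two quadratic equations and dividing by `l - m` gives the trace.
    have h0 : algebraMap F D (l - m) ≠ 0 := by
      rw [Ne, FaithfulSMul.algebraMap_eq_zero_iff]; exact sub_ne_zero.2 hlm
    apply mul_right_cancel₀ h0
    rw [map_sub, mul_sub, hl, hm, ← map_sub, ← map_mul, add_sub_add_right_eq_sub, ← map_mul,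
      ← map_mul, ← map_sub]
    congr 1; ring
  refine ⟨l, m, hlm, hp, ?_⟩
  rw [hp, ← map_mul, ← map_mul, ← sub_eq_iff_eq_add', ← map_sub] at hl
  rw [← hl]
  congr 1; ring

theorem Submodule.diagonal_mem_of_single_mem {S : Submodule F (Matrix (Fin n) (Fin n) D)}
    (hE : ∀ i, Matrix.single i i 1 ∈ S)
    (δ : Fin n → F) : Matrix.diagonal (fun i => algebraMap F D (δ i)) ∈ S := by
  have : Matrix.diagonal (fun i => algebraMap F D (δ i)) =
      ∑ i, δ i • (Matrix.single i i 1 : Matrix (Fin n) (Fin n) D) := by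
    ext k l
    rw [Matrix.sum_apply]
    simp [Matrix.single_apply, Matrix.diagonal_apply, Algebra.smul_def, ite_and]
  rw [this]
  exact S.sum_mem fun i _ => S.smul_mem _ (hE i)

namespace IsExtremal

variable [FiniteDimensional F D] {S : Submodule F (Matrix (Fin n) (Fin n) D)}

/-- Adding `s E_ii` keeps the matrix in `S`, so the corner has two distinct eigenvalues in `F` for
every `s`; `s² + 4c²` is the square of their difference. -/
theorem exists_corner_mem (hS : IsExtremal S) (hE : ∀ i, Matrix.single i i 1 ∈ S)
    {i j : Fin n} (hij : i ≠ j) {a : D} (ha : a ≠ 0) (r : Equiv.Perm (Fin n))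
    (hri : ∀ k, k ≠ i → r i < r k) (hrj : ∀ k, k ≠ i → k ≠ j → r j < r k) :
    ∃ M ∈ S, M j i = a ∧ (∀ k l, k ≠ i → k ≠ j → r l < r k → M k l = 0) ∧ (∀ k, M k k = 0) ∧
      ∃ c : F, c ≠ 0 ∧ a * M i j = algebraMap F D (c * c) ∧
        ∀ s : F, ∃ z : F, z ≠ 0 ∧ s * s + 4 * (c * c) = z * z := by
  obtain ⟨φ, hφ⟩ := exists_retraction F D
  obtain ⟨M, hM, hlow, hdiag⟩ := hS.exists_mem r hφ (Matrix.single j i a) 0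
  have hMji : M j i = a := by rw [hlow j i (hri j hij.symm)]; simp
  have hrow : ∀ k l, k ≠ i → k ≠ j → r l < r k → M k l = 0 := fun k l _ hk' h => by
    rw [hlow k l h, Matrix.single_apply_of_row_ne (Ne.symm hk')]
  have hinv : ∀ k, k ≠ i → k ≠ j → M k i = 0 ∧ M k j = 0 := fun k hk hk' =>
    ⟨hrow k i hk hk' (hri k hk), hrow k j hk hk' (hrj k hk hk')⟩
  have hcor : ∀ s : F, ∃ l m : F, l ≠ m ∧
      a * (M i i + algebraMap F D s) * a⁻¹ + M j j = algebraMap F D (l + m) ∧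
      a * (M i i + algebraMap F D s) * a⁻¹ * M j j - a * M i j = algebraMap F D (l * m) := fun s => by
    have := (hS.diag _ (S.add_mem hM (S.smul_mem s (hE i)))).exists_corner_eigenvalues hij
      (by simpa [hMji, hij] using ha) (fun k hk hk' => by
        simpa [hk, hk', Matrix.single_apply, Ne.symm hk] using hinv k hk hk')
    simpa [hMji, hij, Algebra.algebraMap_eq_smul_one, Matrix.single_apply] using this
  have hconj : ∀ s : F, a * (M i i + algebraMap F D s) * a⁻¹ =
      a * M i i * a⁻¹ + algebraMap F D s := fun s => by
    rw [mul_add, add_mul, ← Algebra.commutes, mul_assoc (algebraMap F D s), mul_inv_cancel₀ ha,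
      mul_one]
  simp only [hconj] at hcor
  obtain ⟨l0, m0, hlm0, hp0, hq0⟩ := hcor 0
  obtain ⟨l1, m1, hlm1, hp1, hq1⟩ := hcor 1
  -- Passing from `s = 0` to `s = 1` changes the corner determinant by `M j j`, which therefore lies
  -- in `F`, where `φ` sees it. The trace then settles `M i i`.
  have hβ : M j j = 0 := by
    have : M j j = algebraMap F D (l1 * m1 - l0 * m0) := by
      rw [map_sub, ← hq1, ← hq0, map_one, map_zero]; noncomm_ring
    have h2 := hdiag j
    rw [this, hφ] at h2
    rw [this, h2]; exact map_zero _
  have hα : M i i = 0 := by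
    rw [hβ, map_zero, add_zero, add_zero, mul_inv_eq_iff_eq_mul₀ ha, Algebra.commutes] at hp0
    have h1 := mul_left_cancel₀ ha hp0
    have h2 := hdiag i
    rw [h1, hφ] at h2
    rw [h1, h2]; exact map_zero _
  simp only [hα, hβ, mul_zero, zero_mul, zero_add, add_zero, zero_sub] at hcor
  have hinjF := (algebraMap F D).injective
  -- At `s = 0` the trace is zero, so the eigenvalues are `c` and `-c`; their being distinct gives
  -- `c ≠ 0`.
  obtain ⟨c, m, hcm, hp, hq⟩ := hcor 0
  obtain rfl : m = -c := by
    rw [eq_neg_iff_add_eq_zero, add_comm]; exact (hinjF hp).symm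
  have hf : a * M i j = algebraMap F D (c * c) := by
    rw [← neg_inj, hq, mul_neg, map_neg]
  have hc : c ≠ 0 := by rintro rfl; simp at hcm
  have hMkk : ∀ k, k ≠ i → k ≠ j → M k k = 0 := fun k hk hk' => by
    obtain ⟨μ, hμ⟩ := (hS.diag M hM).diag_mem_range r k (fun k' l h1 h2 => by
      refine hrow k' l ?_ ?_ (h1.trans_lt h2)
      · rintro rfl; exact absurd (hri k hk) (not_lt.2 h2.le)
      · rintro rfl; exact absurd (hrj k hk hk') (not_lt.2 h2.le)) (fun l hl => hrow k l hk hk' hl)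
    have h2 := hdiag k
    rw [hμ, hφ] at h2
    rw [hμ, h2]; exact map_zero _
  refine ⟨M, hM, hMji, hrow, fun k => ?_, c, hc, hf, fun s => ?_⟩
  · by_cases h1 : k = i
    · rw [h1, hα]
    by_cases h2 : k = j
    · rw [h2, hβ]
    exact hMkk k h1 h2
  · obtain ⟨l, m, hlm, hp, hq⟩ := hcor s
    refine ⟨l - m, sub_ne_zero.2 hlm, ?_⟩
    have hs : s = l + m := hinjF hp
    have hcc : -(c * c) = l * m := hinjF (by rw [map_neg, ← hf, hq])
    linear_combination (s + l + m) * hs - 4 * hcc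

/-- Adding `c` or `-c` on the diagonal outside `{i, j}` gives two matrices of `S`, both with square
`c²`. Comparing these squares leaves `2c (g k + g l) M k l = 0`, which kills every entry outside the
corner. -/
theorem eq_offDiagonal_of_corner (hS : IsExtremal S) (hE : ∀ i, Matrix.single i i 1 ∈ S)
    {i j : Fin n} (hij : i ≠ j) {a : D} (ha : a ≠ 0) {r : Equiv.Perm (Fin n)}
    (hri : ∀ k, k ≠ i → r i < r k) (hrj : ∀ k, k ≠ i → k ≠ j → r j < r k)
    {M : Matrix (Fin n) (Fin n) D} (hM : M ∈ S) (hMji : M j i = a)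
    (hrow : ∀ k l, k ≠ i → k ≠ j → r l < r k → M k l = 0) (hd : ∀ k, M k k = 0)
    {c : F} (hc : c ≠ 0) (h2 : (2 : F) ≠ 0) (hf : a * M i j = algebraMap F D (c * c)) :
    Matrix.single j i a + Matrix.single i j (M i j) = M := by
  have hinjF := (algebraMap F D).injective
  let g : Fin n → F := fun k => if k = i ∨ k = j then 0 else 1
  have hg0 : ∀ k, k ≠ i → k ≠ j → g k = 1 := fun k hk hk' => by simp [g, hk, hk']
  have hgi : g i = 0 := by simp [g]
  have hgj : g j = 0 := by simp [g]
  have hsq : ∀ t : F, t * t = c * c → ∀ k l,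
      ((M + Matrix.diagonal fun k => algebraMap F D (t * g k)) *
      (M + Matrix.diagonal fun k => algebraMap F D (t * g k))) k l =
        ((c * c) • (1 : Matrix (Fin n) (Fin n) D)) k l := by
    intro t ht k l
    revert k l
    have key : ((M + Matrix.diagonal fun k => algebraMap F D (t * g k)) *
      (M + Matrix.diagonal fun k => algebraMap F D (t * g k))) =
        ((c * c) • (1 : Matrix (Fin n) (Fin n) D)) := by
      set B := M + Matrix.diagonal fun k => algebraMap F D (t * g k) with hB
      have hBne : ∀ k l, k ≠ l → B k l = M k l := fun k l h => by
        simp [hB, Matrix.diagonal_apply_ne _ h]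
      have hBeq : ∀ k, B k k = M k k + algebraMap F D (t * g k) := fun k => by simp [hB]
      rw [← sub_eq_zero]
      refine (hS.diag B (S.add_mem hM
        (S.diagonal_mem_of_single_mem hE _))).eq_zero_of_forall_eigenvector _ fun μ v hv hBv => ?_
      -- If the top coordinate lies in `{i, j}`, so does the whole support and the corner equation
      -- reads `μ² = c²`; otherwise `μ` is the diagonal entry `t`.
      have hμ : μ * μ = c * c := by
        obtain ⟨k, hk, htop⟩ := exists_top r hv
        by_cases hkij : k = i ∨ k = j
        · have := corner_quadratic hij (M := B) (by rw [hBne _ _ hij.symm, hMji]; exact ha) hv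
            (fun l hl hl' => htop l (by
              rcases hkij with rfl | rfl
              · exact hri l hl
              · exact hrj l hl hl')) hBv
          rw [hBne _ _ hij.symm, hBne _ _ hij, hBeq, hBeq, hgi, hgj, hd i, hd j, hMji, hf] at this
          simp only [mul_zero, map_zero, zero_mul, add_zero, zero_sub] at this
          rw [← map_mul, eq_comm, add_neg_eq_zero] at this
          exact hinjF this
        · push Not at hkij
          have := eigenvalue_eq_of_top r hBv hk htop fun l hl => by
            rw [hBne _ _ (by rintro rfl; exact lt_irrefl _ hl)]
            exact hrow k l hkij.1 hkij.2 hl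
          rw [hBeq, hd k, hg0 k hkij.1 hkij.2, zero_add, mul_one] at this
          rw [← hinjF this, ht]
      rw [Matrix.sub_mulVec, ← Matrix.mulVec_mulVec, hBv, Matrix.mulVec_smul, hBv, smul_smul, hμ,
        Matrix.smul_mulVec, Matrix.one_mulVec, sub_self]
    intro k l; rw [key]
  have hanti : ∀ k l, (g k + g l) • M k l = 0 := fun k l => by
    have h1 := hsq c rfl k l
    rw [← hsq (-c) (by ring) k l] at h1
    simp only [add_mul, mul_add, Matrix.add_apply, Matrix.mul_diagonal, Matrix.diagonal_mul,
      Matrix.diagonal_mul_diagonal] at h1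
    have h3 : (2 * c) • ((g k + g l) • M k l) = 0 := by
      rw [← Algebra.commutes, ← Algebra.commutes, ← Algebra.smul_def, ← Algebra.smul_def,
        ← Algebra.smul_def, ← Algebra.smul_def] at h1
      have e : ∀ x y : F, algebraMap F D (c * x) * algebraMap F D (c * y) =
          algebraMap F D (-c * x) * algebraMap F D (-c * y) := fun x y => by
        rw [← map_mul, ← map_mul]; congr 1; ring
      simp only [e] at h1
      linear_combination (norm := module) h1
    exact (smul_eq_zero.1 h3).resolve_left (mul_ne_zero h2 hc)
  have hzero : ∀ k l, ¬ ((k = i ∨ k = j) ∧ (l = i ∨ l = j)) → M k l = 0 := fun k l h => by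
    refine (smul_eq_zero.1 (hanti k l)).resolve_left ?_
    by_cases h1 : k = i ∨ k = j <;> by_cases h2 : l = i ∨ l = j <;> simp_all [g, one_add_one_eq_two]
  ext k l
  by_cases h : (k = i ∨ k = j) ∧ (l = i ∨ l = j)
  · obtain ⟨rfl | rfl, rfl | rfl⟩ := h <;> simp [hd, hMji, hij, hij.symm]
  · rw [hzero k l h]
    simp only [Matrix.add_apply, Matrix.single_apply]
    rw [if_neg (by tauto), if_neg (by tauto), add_zero]

theorem exists_offDiagonal_mem (hS : IsExtremal S) (hE : ∀ i, Matrix.single i i 1 ∈ S)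
    {i j : Fin n} (hij : i ≠ j) {a : D} (ha : a ≠ 0) :
    ∃ (f : D) (c : F), c ≠ 0 ∧ a * f = algebraMap F D (c * c) ∧
      Matrix.single j i a + Matrix.single i j f ∈ S ∧
      ∀ s : F, ∃ z : F, z ≠ 0 ∧ s * s + 4 * (c * c) = z * z := by
  obtain ⟨r, hri, hrj⟩ := exists_perm_first_second hij
  obtain ⟨M, hM, hMji, hrow, hd, c, hc, hf, hz⟩ := hS.exists_corner_mem hE hij ha r hri hrj
  have h2 : (2 : F) ≠ 0 := fun h => by
    obtain ⟨z, hz0, hz⟩ := hz 0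
    apply hz0
    rw [show (4 : F) = 2 * 2 by norm_num, h] at hz
    simpa using hz.symm
  refine ⟨M i j, c, hc, hf, ?_, hz⟩
  rwa [hS.eq_offDiagonal_of_corner hE hij ha hri hrj hM hMji hrow hd hc h2 hf]

end IsExtremal

/-! ### Quadratic conjugations and their uniqueness. -/

/-- A linear map sending every element to its conjugate with respect to a quadratic polynomial
over `F`. -/
structure IsQuadraticConj (F : Type*) {D : Type*} [Field F] [DivisionRing D] [Algebra F D]
    (σ : D → D) : Prop where
  map_algebraMap : ∀ a : F, σ (algebraMap F D a) = algebraMap F D a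
  trace : ∀ x, ∃ t : F, x + σ x = algebraMap F D t
  norm : ∀ x, ∃ m : F, x * σ x = algebraMap F D m

namespace IsQuadraticConj

variable {σ τ : D → D}

/-- Two distinct monic quadratic polynomials over `F` with root `x` would differ by a nonzero
polynomial of degree at most one, placing `x` in `F`. -/
theorem eq_of_trace_norm (hσ : IsQuadraticConj F σ) {x y : D} {t m : F}
    (hx : ∀ a : F, x ≠ algebraMap F D a) (ht : x + y = algebraMap F D t)
    (hm : x * y = algebraMap F D m) : σ x = y := by
  obtain ⟨t', ht'⟩ := hσ.trace x
  obtain ⟨m', hm'⟩ := hσ.norm x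
  have h : x * algebraMap F D (t' - t) = algebraMap F D (m' - m) := by
    rw [map_sub, map_sub, ← ht, ← ht', ← hm, ← hm']; noncomm_ring
  have h0 : t' = t := by
    by_contra hne
    have h1 : algebraMap F D (t' - t) ≠ 0 := by
      rw [Ne, FaithfulSMul.algebraMap_eq_zero_iff]; exact sub_ne_zero.2 hne
    refine hx ((m' - m) / (t' - t)) ?_
    rw [map_div₀, ← h, mul_div_cancel_right₀ _ h1]
  rw [h0, ← ht] at ht'
  exact add_left_cancel ht'

theorem unique (hσ : IsQuadraticConj F σ) (hτ : IsQuadraticConj F τ) : τ = σ := by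
  ext x
  by_cases h : ∃ a : F, x = algebraMap F D a
  · obtain ⟨a, rfl⟩ := h
    rw [hσ.map_algebraMap, hτ.map_algebraMap]
  · push Not at h
    obtain ⟨t, ht⟩ := hσ.trace x
    obtain ⟨m, hm⟩ := hσ.norm x
    exact hτ.eq_of_trace_norm h ht hm

theorem involutive (hσ : IsQuadraticConj F σ) (x : D) : σ (σ x) = x := by
  by_cases h : ∃ a : F, x = algebraMap F D a
  · obtain ⟨a, rfl⟩ := h
    rw [hσ.map_algebraMap, hσ.map_algebraMap]
  · push Not at h
    obtain ⟨t, ht⟩ := hσ.trace x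
    obtain ⟨m, hm⟩ := hσ.norm x
    have hy : σ x = algebraMap F D t - x := by rw [← ht, add_sub_cancel_left]
    refine hσ.eq_of_trace_norm (t := t) (m := m) (fun a ha => h (t - a) ?_) ?_ ?_
    · rw [map_sub, ← ha, hy, sub_sub_cancel]
    · rw [add_comm, ht]
    · rw [← hm, hy, sub_mul, mul_sub, Algebra.commutes]

theorem exists_of_fixed (hσ : IsQuadraticConj F σ) (h2 : (2 : F) ≠ 0) {x : D} (hx : σ x = x) :
    ∃ a : F, x = algebraMap F D a := by
  obtain ⟨t, ht⟩ := hσ.trace x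
  refine ⟨t / 2, ?_⟩
  have h2' : (2 : D) ≠ 0 := by
    rw [← map_ofNat (algebraMap F D) 2, Ne, FaithfulSMul.algebraMap_eq_zero_iff]; exact h2
  rw [map_div₀, ← ht, hx, map_ofNat, eq_div_iff h2', mul_two]

end IsQuadraticConj

/-! ### Arithmetic of the base field. -/

theorem IsPythagorean.of_forall_add {c : F} (hc : c ≠ 0) (h2 : (2 : F) ≠ 0)
    (h : ∀ s : F, ∃ z : F, z ≠ 0 ∧ s * s + 4 * (c * c) = z * z) : IsPythagorean F := by
  intro x y
  rcases eq_or_ne y 0 with rfl | hy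
  · exact ⟨x, by ring⟩
  obtain ⟨z, -, hz⟩ := h (2 * c * x / y)
  refine ⟨y / (2 * c) * z, ?_⟩
  have : (y / (2 * c) * z) ^ 2 = (y / (2 * c)) ^ 2 * (z * z) := by ring
  rw [this, ← hz]
  field_simp
  ring

/-- A sum of squares is a square `w²`, and `s = 2cw` shows that `4c²(w² + 1)` is nonzero. -/
theorem IsSemireal.of_forall_add {c : F} (hc : c ≠ 0) (h2 : (2 : F) ≠ 0)
    (h : ∀ s : F, ∃ z : F, z ≠ 0 ∧ s * s + 4 * (c * c) = z * z) : IsSemireal F := by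
  have hP := IsPythagorean.of_forall_add hc h2 h
  refine ⟨fun {s} hs => ?_⟩
  have hsq : ∃ w : F, s = w ^ 2 := by
    induction hs with
    | zero => exact ⟨0, by simp⟩
    | sq_add a _ ih =>
      obtain ⟨w, rfl⟩ := ih
      obtain ⟨z, hz⟩ := hP a w
      exact ⟨z, by rw [← hz, sq a]⟩
  obtain ⟨w, rfl⟩ := hsq
  intro h0
  obtain ⟨z, hz0, hz⟩ := h (2 * c * w)
  have : z * z = 0 := by rw [← hz]; linear_combination 4 * c * c * h0
  exact hz0 (mul_self_eq_zero.1 this)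

/-! ### Normalisation to Hermitian form. -/

theorem IsFDiagonalisable.mulVec_eq_zero_of_sq {M : Matrix (Fin n) (Fin n) D}
    (hM : IsFDiagonalisable F M) {w : Fin n → D} (h : M.mulVec (M.mulVec w) = 0) :
    M.mulVec w = 0 := by
  obtain ⟨P, δ, rfl⟩ := hM
  set Δ := Matrix.diagonal fun i => algebraMap F D (δ i)
  have h1 : Δ.mulVec (Δ.mulVec (P⁻¹.val.mulVec w)) = 0 := by
    have := congrArg P⁻¹.val.mulVec h
    simp only [Matrix.mulVec_mulVec, Matrix.mulVec_zero] at this ⊢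
    rw [← this]
    congr 1
    simp [mul_assoc]
  have h2 : Δ.mulVec (P⁻¹.val.mulVec w) = 0 := by
    ext i
    have := congrFun h1 i
    simp only [Δ, Matrix.mulVec_diagonal, Pi.zero_apply, mul_eq_zero] at this ⊢
    tauto
  rw [← Matrix.mulVec_mulVec, ← Matrix.mulVec_mulVec, h2, Matrix.mulVec_zero]

/-- Three positions of a normalised extremal space: the last off-diagonal ratio is one. -/
theorem IsExtremal.ratio_eq_one {S : Submodule F (Matrix (Fin n) (Fin n) D)}
    (hS : IsExtremal S) (hE : ∀ i, Matrix.single i i 1 ∈ S) {o i j : Fin n}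
    (hio : i ≠ o) (hjo : j ≠ o) (hij : i ≠ j) (h2 : (2 : F) ≠ 0) {ρ : F}
    (hi : Matrix.single i o 1 + Matrix.single o i 1 ∈ S)
    (hj : Matrix.single j o 1 + Matrix.single o j 1 ∈ S)
    (h : Matrix.single j i 1 + Matrix.single i j (algebraMap F D ρ) ∈ S) : ρ = 1 := by
  set p := algebraMap F D ρ
  have hp : algebraMap F D ρ = p := rfl
  obtain ⟨A, hA, hAo, hAi, hAj⟩ : ∃ A ∈ S,
      (∀ k, A k o = if k = o then 2 else if k = i then 2 else if k = j then 2 else 0) ∧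
      (∀ k, A k i = if k = o then 2 else if k = i then 1 + p else if k = j then 2 else 0) ∧
      (∀ k, A k j = if k = o then 2 else if k = i then 2 * p else if k = j then 2 else 0) := by
    -- The diagonal is chosen so that `A` kills `(1, -2, 1)` in the coordinates `o, i, j`.
    refine ⟨_, S.add_mem (S.add_mem (S.smul_mem (2 : F) (hE o)) (S.add_mem
      (S.smul_mem (1 + ρ) (hE i)) (S.smul_mem (2 : F) (hE j)))) (S.smul_mem (2 : F)
      (S.add_mem h (S.add_mem hi hj))), fun k => ?_, fun k => ?_, fun k => ?_⟩
    all_goals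
      simp only [Matrix.add_apply, Matrix.smul_apply, Matrix.single_apply]
      simp only [Algebra.smul_def, map_add, map_one, map_ofNat, hp]
      by_cases hk : k = o
      · subst hk; simp [hio, hjo, hij, hio.symm, hjo.symm, hij.symm]
      by_cases hk' : k = i
      · subst hk'; simp [hio, hjo, hij, hio.symm, hjo.symm, hij.symm]
      by_cases hk'' : k = j
      · subst hk''; simp [hio, hjo, hij, hio.symm, hjo.symm, hij.symm]
      simp [hk, hk', hk'', Ne.symm hk, Ne.symm hk', Ne.symm hk'']
  -- `A` maps this vector to `2(p - 1)(1, -2, 1)`, which lies in its kernel; as `A` and `A²` have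
  -- the same kernel, `2(p - 1) = 0`.
  have hsq := (hS.diag A hA).mulVec_eq_zero_of_sq
    (w := Pi.single o (p + 2) + Pi.single j (-3))
  have hw : A.mulVec (Pi.single o (p + 2) + Pi.single j (-3)) =
      Pi.single o (2 * (p - 1)) + Pi.single i (-4 * (p - 1)) + Pi.single j (2 * (p - 1)) := by
    ext k
    rw [Matrix.mulVec_add, Matrix.mulVec_single, Matrix.mulVec_single]
    simp only [Pi.add_apply, Pi.smul_apply, MulOpposite.smul_eq_mul_unop, Matrix.col_apply,
      MulOpposite.unop_op, hAo, hAj, Pi.single_apply]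
    by_cases hk : k = o
    · subst hk; simp [hio.symm, hjo.symm]; grind
    by_cases hk' : k = i
    · subst hk'; simp [hio, hij]; grind
    by_cases hk'' : k = j
    · subst hk''; simp [hjo, hij.symm]; grind
    simp [hk, hk', hk'']
  have hk : A.mulVec (Pi.single o (2 * (p - 1)) + Pi.single i (-4 * (p - 1)) +
      Pi.single j (2 * (p - 1))) = 0 := by
    ext k
    rw [Matrix.mulVec_add, Matrix.mulVec_add, Matrix.mulVec_single, Matrix.mulVec_single,
      Matrix.mulVec_single]
    simp only [Pi.add_apply, Pi.smul_apply, MulOpposite.smul_eq_mul_unop, Matrix.col_apply,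
      MulOpposite.unop_op, hAo, hAi, hAj, Pi.zero_apply]
    by_cases hk : k = o
    · subst hk; simp; noncomm_ring
    by_cases hk' : k = i
    · subst hk'; simp [hio]; noncomm_ring
    by_cases hk'' : k = j
    · subst hk''; simp [hjo, hij.symm]; noncomm_ring
    simp [hk, hk', hk'']
  have h0 := congrFun (hw.symm.trans (hsq (by rw [hw, hk]))) o
  simp only [Pi.add_apply, Pi.single_eq_same, Pi.single_eq_of_ne hio.symm,
    Pi.single_eq_of_ne hjo.symm, add_zero, Pi.zero_apply] at h0
  have h3 : algebraMap F D (2 * (ρ - 1)) = 0 := by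
    rw [map_mul, map_sub, map_ofNat, map_one, hp, h0]
  rw [FaithfulSMul.algebraMap_eq_zero_iff] at h3
  exact sub_eq_zero.1 ((mul_eq_zero.1 h3).resolve_left h2)

namespace IsExtremal

variable [FiniteDimensional F D] {S : Submodule F (Matrix (Fin n) (Fin n) D)}

theorem eq_zero_of_single_mem (hS : IsExtremal S) {i j : Fin n} (hij : i ≠ j) {g : D}
    (h : Matrix.single i j g ∈ S) : g = 0 := by
  obtain ⟨r, hri, -⟩ := exists_perm_first_second hij
  have := (hS.diag _ h).eq_zero_of_strictUpper r fun k l hkl => by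
    rw [Matrix.single_apply, if_neg]
    rintro ⟨rfl, rfl⟩
    exact absurd (hri _ hij.symm) (not_lt.2 hkl)
  simpa using congrFun (congrFun this i) j

theorem exists_quadraticConj (hS : IsExtremal S) (hE : ∀ i, Matrix.single i i 1 ∈ S)
    {i j : Fin n} (hij : i ≠ j) (h1 : Matrix.single j i 1 + Matrix.single i j 1 ∈ S) :
    ∃ σ : D → D, IsQuadraticConj F σ ∧ IsNormSquareValued F σ ∧
      ∀ a, Matrix.single j i a + Matrix.single i j (σ a) ∈ S := by
  have hex : ∀ a : D, ∃ f : D, (∃ c : F, a * f = algebraMap F D (c ^ 2)) ∧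
      Matrix.single j i a + Matrix.single i j f ∈ S := fun a => by
    rcases eq_or_ne a 0 with rfl | ha
    · exact ⟨0, ⟨0, by simp⟩, by simp⟩
    · obtain ⟨f, c, -, hf, hmem, -⟩ := hS.exists_offDiagonal_mem hE hij ha
      exact ⟨f, ⟨c, by rw [hf, sq]⟩, hmem⟩
  choose σ hnorm hσ using hex
  have huniq : ∀ a f, Matrix.single j i a + Matrix.single i j f ∈ S → σ a = f := fun a f hf => by
    have : Matrix.single i j (σ a - f) ∈ S := by
      convert S.sub_mem (hσ a) hf using 1
      ext k l
      simp only [Matrix.sub_apply, Matrix.add_apply, Matrix.single_apply]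
      split_ifs <;> simp
    exact sub_eq_zero.1 (hS.eq_zero_of_single_mem hij this)
  have hone : σ 1 = 1 := huniq 1 1 h1
  have hadd : ∀ a b, σ (a + b) = σ a + σ b := fun a b => huniq _ _ <| by
    convert S.add_mem (hσ a) (hσ b) using 1
    rw [Matrix.single_add, Matrix.single_add]; abel
  refine ⟨σ, ⟨fun s => ?_, fun x => ?_, fun x => ?_⟩, hnorm, hσ⟩
  · refine huniq _ _ ?_
    convert S.smul_mem s h1 using 1
    rw [smul_add, Matrix.smul_single, Matrix.smul_single, Algebra.algebraMap_eq_smul_one]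
  -- Polarisation: `N(x + 1) - N(x) - 1` is the trace of `x`.
  · obtain ⟨c, hc⟩ := hnorm (x + 1)
    obtain ⟨d, hd⟩ := hnorm x
    refine ⟨c ^ 2 - d ^ 2 - 1, ?_⟩
    rw [map_sub, map_sub, ← hc, ← hd, hadd, hone, map_one]
    noncomm_ring
  · obtain ⟨c, hc⟩ := hnorm x
    exact ⟨_, hc⟩

/-- Conjugating `E_io + c_i² E_oi` by the diagonal matrix of the `c_i`, with `c_o = 1`, gives `c_i
(E_io + E_oi)`. -/
theorem exists_conj_symm_mem (hS : IsExtremal S) (hE : ∀ i, Matrix.single i i 1 ∈ S) (o : Fin n) :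
    ∃ P : (Matrix (Fin n) (Fin n) D)ˣ,
      (∀ i, Matrix.single i i 1 ∈ S.map (conjLinear F P).toLinearMap) ∧
      ∀ i, i ≠ o → Matrix.single i o 1 + Matrix.single o i 1 ∈
        S.map (conjLinear F P).toLinearMap := by
  have hex : ∀ i : Fin n, ∃ c : F, c ≠ 0 ∧ (i = o → c = 1) ∧ (i ≠ o →
      Matrix.single i o 1 + Matrix.single o i (algebraMap F D (c * c)) ∈ S) := fun i => by
    by_cases hi : i = o
    · exact ⟨1, one_ne_zero, fun _ => rfl, fun h => absurd hi h⟩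
    · obtain ⟨f, c, hc, hf, hmem, -⟩ := hS.exists_offDiagonal_mem hE (Ne.symm hi) one_ne_zero
      rw [one_mul] at hf
      exact ⟨c, hc, fun h => absurd h hi, fun _ => hf ▸ hmem⟩
  choose c hc hco hmem using hex
  have hinv : ∀ i, algebraMap F D (c i) * algebraMap F D (c i)⁻¹ = 1 := fun i => by
    rw [← map_mul, mul_inv_cancel₀ (hc i), map_one]
  let P : (Matrix (Fin n) (Fin n) D)ˣ :=
    ⟨Matrix.diagonal fun i => algebraMap F D (c i), Matrix.diagonal fun i => algebraMap F D (c i)⁻¹,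
      by rw [Matrix.diagonal_mul_diagonal]; simp [hc],
      by rw [Matrix.diagonal_mul_diagonal]; simp [hc]⟩
  have hP : ∀ i j (x : D), conjLinear F P (Matrix.single i j x) =
      Matrix.single i j (algebraMap F D (c i) * x * algebraMap F D (c j)⁻¹) := fun i j x => by
    change Matrix.diagonal (fun i => algebraMap F D (c i)) * Matrix.single i j x *
      Matrix.diagonal (fun i => algebraMap F D (c i)⁻¹) = _
    ext k l
    rw [Matrix.mul_diagonal, Matrix.diagonal_mul, Matrix.single_apply, Matrix.single_apply]
    split_ifs with h
    · rw [h.1, h.2]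
    · simp
  refine ⟨P, fun i => ⟨_, hE i, ?_⟩, fun i hi => ⟨_, S.smul_mem (c i)⁻¹ (hmem i hi), ?_⟩⟩
  · rw [LinearEquiv.coe_coe, hP, mul_one, hinv]
  · rw [LinearEquiv.coe_coe, map_smul, map_add, hP, hP, hco o rfl, smul_add, Matrix.smul_single,
      Matrix.smul_single]
    congr 2
    · simp [Algebra.smul_def, hc]
    · simp [Algebra.smul_def, hc]

/-- Each matrix is compared with the Hermitian matrix of zero diagonal having the same strictly
lower part, which lies in `S`. In `S` the difference is upper triangular, hence diagonal over `F`; a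
Hermitian diagonal is fixed by `σ`, hence also over `F`. -/
theorem eq_hermitianMatrices (hS : IsExtremal S) (hE : ∀ i, Matrix.single i i 1 ∈ S)
    (h2 : (2 : F) ≠ 0) {σ : D → D} (hσ : IsQuadraticConj F σ)
    (h : ∀ i j, i < j → ∀ a, Matrix.single j i a + Matrix.single i j (σ a) ∈ S) :
    (S : Set (Matrix (Fin n) (Fin n) D)) = hermitianMatrices n σ := by
  have hN : ∀ M : Matrix (Fin n) (Fin n) D, (Matrix.of fun k l =>
      if l < k then M k l else if k < l then σ (M l k) else 0) ∈ S := fun M => by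
    have : (Matrix.of fun k l =>
      if l < k then M k l else if k < l then σ (M l k) else 0) = ∑ p : Fin n × Fin n,
        if p.1 < p.2 then Matrix.single p.2 p.1 (M p.2 p.1) +
          Matrix.single p.1 p.2 (σ (M p.2 p.1)) else 0 := by
      ext k l
      rw [Matrix.sum_apply]
      rcases lt_trichotomy k l with hkl | rfl | hkl
      · rw [Finset.sum_eq_single (k, l)]
        · simp [hkl, hkl.not_gt, hkl.ne, hkl.ne']
        · rintro ⟨a, b⟩ - hab
          by_cases hlt : a < b
          · rw [if_pos hlt, Matrix.add_apply, Matrix.single_apply, Matrix.single_apply, if_neg,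
              if_neg, add_zero]
            · rintro ⟨rfl, rfl⟩; exact hab rfl
            · rintro ⟨rfl, rfl⟩; exact lt_asymm hlt hkl
          · rw [if_neg hlt]; rfl
        · simp
      · rw [Finset.sum_eq_zero]
        · simp
        · rintro ⟨a, b⟩ -
          by_cases hlt : a < b
          · rw [if_pos hlt, Matrix.add_apply, Matrix.single_apply, Matrix.single_apply, if_neg,
              if_neg, add_zero]
            · rintro ⟨rfl, h'⟩; exact hlt.ne h'.symm
            · rintro ⟨rfl, h'⟩; exact hlt.ne h'
          · rw [if_neg hlt]; rfl
      · rw [Finset.sum_eq_single (l, k)]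
        · simp [hkl, hkl.ne, hkl.ne']
        · rintro ⟨a, b⟩ - hab
          by_cases hlt : a < b
          · rw [if_pos hlt, Matrix.add_apply, Matrix.single_apply, Matrix.single_apply, if_neg,
              if_neg, add_zero]
            · rintro ⟨rfl, rfl⟩; exact lt_asymm hlt hkl
            · rintro ⟨rfl, rfl⟩; exact hab rfl
          · rw [if_neg hlt]; rfl
        · simp
    rw [this]
    refine S.sum_mem fun p _ => ?_
    split_ifs with hp
    · exact h _ _ hp _
    · exact S.zero_mem
  ext M
  rw [SetLike.mem_coe]
  constructor
  · intro hM
    set N : Matrix (Fin n) (Fin n) D := Matrix.of fun k l =>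
      if l < k then M k l else if k < l then σ (M l k) else 0 with hNdef
    have hMN : M - N ∈ S := S.sub_mem hM (hN M)
    have hlow : ∀ k l, l < k → (M - N) k l = 0 := fun k l hkl => by
      simp [hNdef, hkl]
    have hdiag : ∀ k, ∃ μ : F, (M - N) k k = algebraMap F D μ := fun k =>
      (hS.diag _ hMN).diag_mem_range 1 k (fun i j h1 h2 => hlow i j (h1.trans_lt h2))
        (fun j hj => hlow k j hj)
    choose δ hδ using hdiag
    have hz := (hS.diag _ (S.sub_mem hMN (S.diagonal_mem_of_single_mem hE δ))).eq_zero_of_strictUpper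
      1 fun k l hkl => by
      rcases lt_or_eq_of_le hkl with h' | h'
      · have h'' : l < k := h'
        rw [Matrix.sub_apply, hlow k l h'', Matrix.diagonal_apply_ne _ h''.ne', sub_zero]
      · obtain rfl : l = k := h'
        rw [Matrix.sub_apply, hδ, Matrix.diagonal_apply_eq, sub_self]
    have hM' : ∀ k l, M k l = N k l + Matrix.diagonal (fun i => algebraMap F D (δ i)) k l :=
      fun k l => by
        have := congrFun (congrFun hz k) l
        rw [Matrix.sub_apply, Matrix.sub_apply, sub_sub, Matrix.zero_apply, sub_eq_zero] at this
        exact this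
    have hup : ∀ k l, k < l → σ (M l k) = M k l := fun k l hkl => by
      rw [hM' k l, Matrix.diagonal_apply_ne _ hkl.ne, add_zero, hNdef, Matrix.of_apply,
        if_neg hkl.not_gt, if_pos hkl]
    ext k l
    rw [Matrix.transpose_apply, Matrix.map_apply]
    rcases lt_trichotomy k l with hkl | rfl | hkl
    · exact hup k l hkl
    · rw [hM' k k]; simp [hNdef, hσ.map_algebraMap]
    · rw [← hup l k hkl, hσ.involutive]
  · intro hM
    have hM' : ∀ k l, σ (M l k) = M k l := fun k l => congrFun (congrFun hM k) l
    have hd : ∀ k, ∃ a : F, M k k = algebraMap F D a := fun k =>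
      hσ.exists_of_fixed h2 (hM' k k)
    choose δ hδ using hd
    convert S.add_mem (hN M) (S.diagonal_mem_of_single_mem hE δ) using 1
    ext k l
    rcases lt_trichotomy k l with hkl | rfl | hkl
    · simp [hkl, hkl.not_gt, hkl.ne, hM']
    · simp [hδ]
    · simp [hkl, hkl.ne']

end IsExtremal

/-! ### Standard involutions as quadratic conjugations. -/

theorem IsQuaternionConj.isQuadraticConj {σ : D → D} (h : IsQuaternionConj F σ) :
    IsQuadraticConj F σ := by
  obtain ⟨a, b, c, φ, hφ⟩ := h
  have key : ∀ x : D, ∀ t : F, φ x = (t : ℍ[F, a, b, c]) → x = algebraMap F D t := fun x t h =>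
    φ.injective (by rw [h, AlgEquiv.commutes]; rfl)
  refine ⟨fun s => key _ _ ?_, fun x => ⟨2 * (φ x).re + b * (φ x).imI, key _ _ ?_⟩,
    fun x => ⟨(φ x * star (φ x)).re, key _ _ ?_⟩⟩
  · rw [hφ, AlgEquiv.commutes]; exact QuaternionAlgebra.star_coe s
  · rw [map_add, hφ]; exact QuaternionAlgebra.self_add_star' _
  · rw [map_mul, hφ]; exact QuaternionAlgebra.mul_star_eq_coe _

/-- In degree two the fixed subalgebra of `τ` is `F`, so for `x` outside `F` the element `τ x` is
the other root of the quadratic polynomial of `x`. -/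
theorem eq_of_algEquiv_ne_refl {σ : D → D} (hσ : IsQuadraticConj F σ) (hD : IsSeparableQuadratic F D)
    (τ : D ≃ₐ[F] D) (hτ : τ ≠ AlgEquiv.refl) (x : D) : τ x = σ x := by
  by_cases h : ∃ a : F, x = algebraMap F D a
  · obtain ⟨a, rfl⟩ := h
    rw [hσ.map_algebraMap, AlgEquiv.commutes]
  have := Subalgebra.isSimpleOrder_of_finrank hD.1
  have hne : AlgHom.equalizer (τ : D →ₐ[F] D) (AlgHom.id F D) = ⊥ := by
    refine (eq_bot_or_eq_top _).resolve_right fun htop => hτ ?_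
    ext y
    have : y ∈ AlgHom.equalizer (τ : D →ₐ[F] D) (AlgHom.id F D) := htop ▸ Algebra.mem_top
    exact this
  have hx : τ x ≠ x := fun hx => h <| by
    have : x ∈ AlgHom.equalizer (τ : D →ₐ[F] D) (AlgHom.id F D) := hx
    rw [hne, Algebra.mem_bot] at this
    obtain ⟨a, ha⟩ := this
    exact ⟨a, ha.symm⟩
  obtain ⟨t, ht⟩ := hσ.trace x
  obtain ⟨m, hm⟩ := hσ.norm x
  have hy : σ x = algebraMap F D t - x := by rw [← ht, add_sub_cancel_left]
  have h1 : x * (algebraMap F D t - x) = algebraMap F D m := by rw [← hy, hm]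
  have h2 : τ x * (algebraMap F D t - τ x) = algebraMap F D m := by
    rw [← AlgEquiv.commutes τ t, ← map_sub, ← map_mul, h1, AlgEquiv.commutes]
  have h3 : (τ x - x) * (τ x - σ x) = 0 := by
    have e : (τ x - x) * (τ x - σ x) = x * (algebraMap F D t - x) -
        τ x * (algebraMap F D t - τ x) + (τ x * x - x * τ x) := by rw [hy]; noncomm_ring
    rw [e, h1, h2, hD.2.1 x (τ x)]; simp
  exact sub_eq_zero.1 ((mul_eq_zero.1 h3).resolve_left (sub_ne_zero.2 hx))

theorem IsStandardInvolution.unique [CharZero F] [FiniteDimensional F D] {σ τ : D → D} (hσ : IsQuadraticConj F σ)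
    (hτ : IsStandardInvolution F τ) : τ = σ := by
  rcases hτ with ⟨h1, h⟩ | ⟨h1, τ', hne, h⟩ | ⟨-, h⟩ | ⟨h1, -⟩
  · ext x
    rw [h]
    obtain ⟨a, rfl⟩ := (bijective_algebraMap_of_linearEquiv
      (LinearEquiv.ofFinrankEq F D (by rw [h1, Module.finrank_self]))).surjective x
    exact (hσ.map_algebraMap a).symm
  · ext x
    rw [h, eq_of_algEquiv_ne_refl hσ h1 τ' hne]
  · exact hσ.unique h.isQuadraticConj
  · have := h1.2.1
    exact absurd (CharP.cast_eq_zero F 2) (by norm_num)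

/-! ### Structure of `D` when the norm is square-valued. -/

namespace IsQuadraticConj

variable {σ : D → D}

theorem exists_sq_eq_neg_sq (hσ : IsQuadraticConj F σ) (hN : IsNormSquareValued F σ) {x : D}
    (hx : ∀ a : F, x ≠ algebraMap F D a) {m : F} (hm : x * x = algebraMap F D m) :
    ∃ y : D, ∃ c : F, x = c • y ∧ y * y = -1 := by
  obtain ⟨c, hc⟩ := hN x
  rw [hσ.eq_of_trace_norm (y := -x) (t := 0) (m := -m) hx (by simp) (by simp [hm])] at hc
  have hc0 : c ≠ 0 := by
    rintro rfl
    have h0 : x = 0 := by simpa using hc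
    exact hx 0 (by rw [h0, map_zero])
  refine ⟨c⁻¹ • x, c, by rw [smul_smul, mul_inv_cancel₀ hc0, one_smul], ?_⟩
  have hxx : x * x = - algebraMap F D (c ^ 2) := by rw [← hc]; simp
  rw [smul_mul_smul_comm, hxx, smul_neg, Algebra.smul_def, ← map_mul]
  rw [show c⁻¹ * c⁻¹ * c ^ 2 = 1 by field_simp, map_one]

theorem exists_imaginary_unit (hσ : IsQuadraticConj F σ) (hN : IsNormSquareValued F σ)
    (h2 : (2 : F) ≠ 0) {x : D} (hx : ∀ a : F, x ≠ algebraMap F D a) :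
    ∃ y : D, ∃ s c : F, x = algebraMap F D s + c • y ∧ c ≠ 0 ∧ y * y = -1 := by
  obtain ⟨t, ht⟩ := hσ.trace x
  obtain ⟨m, hm⟩ := hσ.norm x
  have hy : σ x = algebraMap F D t - x := by rw [← ht, add_sub_cancel_left]
  rw [hy] at hm
  have hu : ∀ a : F, x - algebraMap F D (t / 2) ≠ algebraMap F D a := fun a ha => by
    rw [sub_eq_iff_eq_add, ← map_add] at ha
    exact hx _ ha
  have hsum : algebraMap F D t = algebraMap F D (t / 2) + algebraMap F D (t / 2) := by
    have : NeZero (2 : F) := ⟨h2⟩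
    rw [← map_add, add_halves]
  have hsq : (x - algebraMap F D (t / 2)) * (x - algebraMap F D (t / 2)) =
      algebraMap F D (-m + t / 2 * (t / 2)) := by
    rw [map_add, map_neg, ← hm, map_mul, hsum]
    have := Algebra.commutes (A := D) (t / 2) x
    rw [sub_mul, mul_sub, mul_sub, mul_sub, mul_add, this]
    abel
  obtain ⟨y, c, hc, hyy⟩ := hσ.exists_sq_eq_neg_sq hN hu hsq
  refine ⟨y, t / 2, c, by rw [← hc]; abel, ?_, hyy⟩
  rintro rfl
  exact hu 0 (by rw [hc]; simp)

/-- After normalisation, commuting square roots of `-1` satisfy `(y - i)(y + i) = 0`. -/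
theorem exists_of_commute (hσ : IsQuadraticConj F σ) (hN : IsNormSquareValued F σ)
    (h2 : (2 : F) ≠ 0) {i x : D} (hi : i * i = -1) (hx : x * i = i * x) :
    ∃ a b : F, x = algebraMap F D a + b • i := by
  by_cases h : ∃ a : F, x = algebraMap F D a
  · obtain ⟨a, rfl⟩ := h
    exact ⟨a, 0, by simp⟩
  push Not at h
  obtain ⟨y, s, c, rfl, hc, hy⟩ := hσ.exists_imaginary_unit hN h2 h
  have hyi : y * i = i * y := by
    rw [add_mul, mul_add, Algebra.commutes, add_right_inj, smul_mul_assoc, mul_smul_comm] at hx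
    exact smul_right_injective D hc hx
  have h0 : (y - i) * (y + i) = 0 := by
    rw [sub_mul, mul_add, mul_add, hy, hi, hyi]; abel
  rcases mul_eq_zero.1 h0 with h1 | h1
  · exact ⟨s, c, by rw [sub_eq_zero.1 h1]⟩
  · exact ⟨s, -c, by rw [eq_neg_of_add_eq_zero_left h1]; simp⟩

/-- If everything commutes with an imaginary unit, then `D` is a separable quadratic extension. -/
theorem isStandardInvolution_of_commute [CharZero F] [FiniteDimensional F D]
    (hσ : IsQuadraticConj F σ) (hN : IsNormSquareValued F σ) {i : D} (hi : i * i = -1)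
    (hiF : ∀ a : F, i ≠ algebraMap F D a) (h : ∀ x, x * i = i * x) :
    IsSeparableQuadratic F D ∧ ∃ τ : D ≃ₐ[F] D, τ ≠ AlgEquiv.refl ∧ ∀ x, σ x = τ x := by
  have h2 : (2 : F) ≠ 0 := two_ne_zero
  have hrep := fun x => hσ.exists_of_commute hN h2 hi (h x)
  have hcomm : ∀ x y : D, x * y = y * x := fun x y => by
    obtain ⟨a, b, rfl⟩ := hrep y
    rw [mul_add, add_mul, mul_smul_comm, smul_mul_assoc, h x, Algebra.commutes]
  have hval : ∀ a b : F, σ (algebraMap F D a + b • i) = algebraMap F D a - b • i := fun a b => by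
    rcases eq_or_ne b 0 with rfl | hb
    · simp [hσ.map_algebraMap]
    · refine hσ.eq_of_trace_norm (t := 2 * a) (m := a * a + b * b) (fun s hs => ?_) ?_ ?_
      · refine hiF ((s - a) / b) ?_
        rw [← eq_sub_iff_add_eq', ← map_sub] at hs
        rw [div_eq_inv_mul, map_mul, ← hs, ← Algebra.smul_def, smul_smul, inv_mul_cancel₀ hb, one_smul]
      · rw [two_mul, map_add]; abel
      · have hbi : b • i * b • i = - algebraMap F D (b * b) := by
          rw [smul_mul_smul_comm, hi, smul_neg, Algebra.algebraMap_eq_smul_one]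
        rw [add_mul, mul_sub, mul_sub, hbi, ← Algebra.commutes a (b • i)]
        simp only [map_add, map_mul]
        abel
  have hfin : Module.finrank F D = 2 := by
    have hind : LinearIndependent F ![(1 : D), i] := by
      rw [LinearIndependent.pair_iff]
      intro s t hst
      have ht : t = 0 := by
        by_contra ht
        refine hiF (-s / t) ?_
        have h1 : t • i = algebraMap F D (-s) := by
          rw [map_neg, Algebra.algebraMap_eq_smul_one, ← eq_neg_of_add_eq_zero_right hst]
        rw [div_eq_inv_mul, map_mul, ← h1, ← Algebra.smul_def, smul_smul, inv_mul_cancel₀ ht,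
          one_smul]
      subst ht
      simpa using hst
    have hspan : ⊤ ≤ Submodule.span F (Set.range ![(1 : D), i]) := fun x _ => by
      obtain ⟨a, b, rfl⟩ := hrep x
      rw [Algebra.algebraMap_eq_smul_one]
      exact Submodule.add_mem _ (Submodule.smul_mem _ _ (Submodule.subset_span ⟨0, rfl⟩))
        (Submodule.smul_mem _ _ (Submodule.subset_span ⟨1, rfl⟩))
    rw [Module.finrank_eq_card_basis (Module.Basis.mk hind hspan), Fintype.card_fin]
  have hsep : Algebra.IsSeparable F D :=
    ⟨fun x => (minpoly.irreducible (Algebra.IsIntegral.isIntegral x)).separable⟩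
  refine ⟨⟨hfin, hcomm, hsep⟩, ?_⟩
  have hmul : ∀ x y, σ (x * y) = σ x * σ y := fun x y => by
    obtain ⟨a, b, rfl⟩ := hrep x
    obtain ⟨c, d, rfl⟩ := hrep y
    have e1 : ∀ b d : F, b • i * d • i = - algebraMap F D (b * d) := fun b d => by
      rw [smul_mul_smul_comm, hi, smul_neg, Algebra.algebraMap_eq_smul_one]
    have e2 : (algebraMap F D a + b • i) * (algebraMap F D c + d • i) =
        algebraMap F D (a * c - b * d) + (a * d + b * c) • i := by
      rw [add_mul, mul_add, mul_add, e1, ← Algebra.commutes c (b • i), add_smul,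
        mul_smul, mul_comm b c, mul_smul, Algebra.smul_def a, Algebra.smul_def c]
      simp only [map_sub, map_mul]
      abel
    rw [e2, hval, hval, hval, sub_mul, mul_sub, mul_sub, e1, ← Algebra.commutes c (b • i),
      add_smul, mul_smul, mul_comm b c, mul_smul, Algebra.smul_def a (d • i),
      Algebra.smul_def c (b • i)]
    simp only [map_sub, map_mul]
    abel
  have hadd : ∀ x y, σ (x + y) = σ x + σ y := fun x y => by
    obtain ⟨a, b, rfl⟩ := hrep x
    obtain ⟨c, d, rfl⟩ := hrep y
    have e : algebraMap F D a + b • i + (algebraMap F D c + d • i) =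
        algebraMap F D (a + c) + (b + d) • i := by rw [map_add, add_smul]; abel
    rw [e, hval, hval, hval, map_add, add_smul]; abel
  let f : D →ₐ[F] D :=
    { toFun := σ
      map_one' := by simpa using hσ.map_algebraMap 1
      map_mul' := hmul
      map_zero' := by simpa using hσ.map_algebraMap 0
      map_add' := hadd
      commutes' := hσ.map_algebraMap }
  refine ⟨AlgEquiv.ofAlgHom f f (AlgHom.ext hσ.involutive) (AlgHom.ext hσ.involutive), ?_,
    fun x => rfl⟩
  intro heq
  obtain ⟨a, ha⟩ := hσ.exists_of_fixed h2 (x := i) (DFunLike.congr_fun heq i)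
  exact hiF a ha

theorem exists_quaternion_unit (hσ : IsQuadraticConj F σ) (hN : IsNormSquareValued F σ)
    (h2 : (2 : F) ≠ 0) {i x : D} (hi : i * i = -1) (hx : x ≠ 0) (hxi : x * i = -(i * x)) :
    ∃ j : D, j * j = -1 ∧ j * i = -(i * j) := by
  have h2' : (2 : D) ≠ 0 := by
    rw [← map_ofNat (algebraMap F D) 2, Ne, FaithfulSMul.algebraMap_eq_zero_iff]; exact h2
  have hi0 : i ≠ 0 := by rintro rfl; simp at hi
  have hne : ∀ y : D, y * i = i * y → y * i = -(i * y) → y = 0 := fun y h1 h3 => by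
    rw [h1] at h3
    have : 2 * (i * y) = 0 := by rw [two_mul]; nth_rw 1 [h3]; simp
    exact ((mul_eq_zero.1 ((mul_eq_zero.1 this).resolve_left h2')).resolve_left hi0)
  have hxF : ∀ a : F, x ≠ algebraMap F D a := by
    rintro a rfl
    exact hx (hne _ (Algebra.commutes a i) hxi)
  -- `x²` commutes with `i`, so it is `a + b i`; it also commutes with `x`, which forces `b = 0`.
  obtain ⟨a, b, hab⟩ := hσ.exists_of_commute hN h2 hi (x := x * x) (by
    rw [mul_assoc, hxi, mul_neg, ← mul_assoc, hxi, neg_mul, neg_neg, mul_assoc])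
  have hb : b = 0 := by
    by_contra hb
    have h3 : x * (x * x) = x * x * x := (mul_assoc _ _ _).symm
    rw [hab, mul_add, add_mul, Algebra.commutes a x, add_right_inj, mul_smul_comm,
      smul_mul_assoc] at h3
    exact hx (hne x (smul_right_injective D hb h3) hxi)
  rw [hb, zero_smul, add_zero] at hab
  obtain ⟨j, c, hj, hjj⟩ := hσ.exists_sq_eq_neg_sq hN hxF hab
  refine ⟨j, hjj, ?_⟩
  have hc : c ≠ 0 := by rintro rfl; exact hx (by simpa using hj)
  rw [hj, smul_mul_assoc, mul_smul_comm, ← smul_neg] at hxi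
  exact smul_right_injective D hc hxi

theorem isStandardInvolution_of_anticommute [CharZero F] [IsSemireal F] (hP : IsPythagorean F)
    [FiniteDimensional F D]
    (hσ : IsQuadraticConj F σ) (hN : IsNormSquareValued F σ) {i j : D} (hi : i * i = -1)
    (hj : j * j = -1) (hji : j * i = -(i * j)) :
    IsQuaternionDivisionAlgebra F D ∧ IsQuaternionConj F σ := by
  have h2 : (2 : F) ≠ 0 := two_ne_zero
  have h2' : (2 : D) ≠ 0 := by
    rw [← map_ofNat (algebraMap F D) 2, Ne, FaithfulSMul.algebraMap_eq_zero_iff]; exact h2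
  let q : QuaternionAlgebra.Basis D (-1 : F) 0 (-1) :=
    { i := i, j := j, k := i * j
      i_mul_i := by simp [hi]
      j_mul_j := by simp [hj]
      i_mul_j := rfl
      j_mul_i := by simp [hji] }
  have hrange : ∀ x : D, ∃ a b c d : F,
      x = algebraMap F D a + b • i + c • j + d • (i * j) := fun x => by
    -- `x - i x i` commutes with `i`, while `x + i x i` anticommutes with it and does commute after
    -- multiplication by `j`.
    obtain ⟨a, b, hab⟩ := hσ.exists_of_commute hN h2 hi (x := x - i * x * i) (by
      rw [sub_mul, mul_sub, mul_assoc (i * x), hi, ← mul_assoc i (i * x), ← mul_assoc i i, hi]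
      noncomm_ring)
    obtain ⟨c, d, hcd⟩ := hσ.exists_of_commute hN h2 hi (x := j * (x + i * x * i)) (by
      have e1 : j * (x + i * x * i) * i = j * (x * i) + j * i * x * (i * i) := by noncomm_ring
      have e2 : i * (j * (x + i * x * i)) = i * j * x + i * (j * i) * x * i := by noncomm_ring
      rw [e1, e2, hji, hi]
      have e3 : i * (-(i * j)) = j := by rw [mul_neg, ← mul_assoc, hi]; simp
      rw [e3]; noncomm_ring)
    have hx : x + i * x * i = - (c • j) + d • (i * j) := by
      have : x + i * x * i = - (j * (j * (x + i * x * i))) := by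
        rw [← mul_assoc, hj]; simp
      rw [this, hcd, mul_add, mul_smul_comm, hji, ← Algebra.commutes, ← Algebra.smul_def]
      simp only [neg_add_rev, smul_neg, neg_neg]
      abel
    have hsum : (2 : F) • x = algebraMap F D a + b • i + (- (c • j) + d • (i * j)) := by
      rw [← hab, ← hx, two_smul]; abel
    refine ⟨2⁻¹ * a, 2⁻¹ * b, -(2⁻¹ * c), 2⁻¹ * d, ?_⟩
    rw [← inv_smul_smul₀ h2 x, hsum, Algebra.algebraMap_eq_smul_one, Algebra.algebraMap_eq_smul_one]
    module
  have hsurj : Function.Surjective q.liftHom := fun x => by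
    obtain ⟨a, b, c, d, rfl⟩ := hrange x
    exact ⟨⟨a, b, c, d⟩, rfl⟩
  have hsq : ∀ {x y : F}, x ^ 2 + y ^ 2 = 0 → x = 0 := fun {x y} h => by
    by_contra hx
    refine IsSemireal.one_add_ne_zero (R := F) (s := (y / x) * (y / x)) (IsSumSq.mul_self _) ?_
    field_simp
    linear_combination h
  have hinj : Function.Injective q.liftHom := by
    rw [injective_iff_map_eq_zero]
    intro z hz
    -- The quaternion norm is a sum of four squares, which vanishes only at zero since `F` is
    -- Pythagorean and formally real.
    have h0 : q.liftHom (z * star z) = 0 := by rw [map_mul, hz, zero_mul]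
    have h1 : ∀ m : F, m = z.re ^ 2 + z.imI ^ 2 + (z.imJ ^ 2 + z.imK ^ 2) →
        z * star z = (m : ℍ[F, -1, 0, -1]) := fun m hm => by
      ext <;> simp <;> first | (rw [hm]; ring) | ring
    rw [h1 _ rfl] at h0
    have h3 : z.re ^ 2 + z.imI ^ 2 + (z.imJ ^ 2 + z.imK ^ 2) = 0 := by
      have := (AlgHom.commutes q.liftHom _).symm.trans h0
      exact (FaithfulSMul.algebraMap_eq_zero_iff F D).1 this
    obtain ⟨u, hu⟩ := hP z.re z.imI
    obtain ⟨v, hv⟩ := hP z.imJ z.imK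
    rw [hu, hv] at h3
    have hu0 := hsq h3
    rw [add_comm] at h3
    have hv0 := hsq h3
    rw [hu0, zero_pow two_ne_zero] at hu
    rw [hv0, zero_pow two_ne_zero] at hv
    ext
    · exact hsq hu
    · exact hsq ((add_comm _ _).trans hu)
    · exact hsq hv
    · exact hsq ((add_comm _ _).trans hv)
  let φ : ℍ[F, -1, 0, -1] ≃ₐ[F] D := AlgEquiv.ofBijective q.liftHom ⟨hinj, hsurj⟩
  have hconj : IsQuaternionConj F fun x => φ (star (φ.symm x)) :=
    ⟨-1, 0, -1, φ.symm, fun x => by simp⟩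
  rw [hσ.unique hconj.isQuadraticConj] at hconj
  refine ⟨⟨?_, ⟨fun x hx => ?_⟩⟩, hconj⟩
  · rw [← φ.toLinearEquiv.finrank_eq, QuaternionAlgebra.finrank_eq_four]
  · rw [Subalgebra.mem_center_iff] at hx
    obtain ⟨a, b, rfl⟩ := hσ.exists_of_commute hN h2 hi (hx i).symm
    have hb : b = 0 := by
      by_contra hb
      have h3 := hx j
      rw [mul_add, add_mul, Algebra.commutes, add_right_inj, mul_smul_comm, smul_mul_assoc] at h3
      have h4 := smul_right_injective D hb h3
      simp only [hji] at h4
      have h5 : 2 * (i * j) = 0 := by rw [two_mul]; nth_rw 1 [← h4]; simp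
      rcases mul_eq_zero.1 ((mul_eq_zero.1 h5).resolve_left h2') with h | h
      · rw [h] at hi; simp at hi
      · rw [h] at hj; simp at hj
    rw [hb, zero_smul, add_zero]
    exact Subalgebra.algebraMap_mem _ a

theorem isStandardInvolution [CharZero F] [IsSemireal F] (hP : IsPythagorean F)
    [FiniteDimensional F D] (hσ : IsQuadraticConj F σ) (hN : IsNormSquareValued F σ) :
    IsStandardInvolution F σ := by
  by_cases h1 : ∀ x : D, ∃ a : F, x = algebraMap F D a
  · left
    refine ⟨?_, fun x => ?_⟩
    · have hbij : Function.Bijective (Algebra.linearMap F D) :=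
        ⟨(algebraMap F D).injective, fun x => (h1 x).imp fun a ha => ha.symm⟩
      rw [← (LinearEquiv.ofBijective _ hbij).finrank_eq, Module.finrank_self]
    · obtain ⟨a, rfl⟩ := h1 x
      exact hσ.map_algebraMap a
  push Not at h1
  obtain ⟨x, hx⟩ := h1
  obtain ⟨i, s, c, hxi, -, hi⟩ := hσ.exists_imaginary_unit hN two_ne_zero hx
  have hiF : ∀ a : F, i ≠ algebraMap F D a := by
    rintro a rfl
    refine hx (s + c * a) ?_
    rw [hxi, map_add, map_mul, Algebra.smul_def]
  right
  by_cases h : ∀ y, y * i = i * y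
  · exact .inl (hσ.isStandardInvolution_of_commute hN hi hiF h)
  push Not at h
  obtain ⟨y, hy⟩ := h
  -- The commutator `y i - i y` anticommutes with `i`, because `i²` is central.
  obtain ⟨j, hj, hji⟩ := hσ.exists_quaternion_unit hN two_ne_zero hi (sub_ne_zero.2 hy) (by
    rw [sub_mul, mul_sub, mul_assoc y i i, hi, ← mul_assoc i i y, hi, mul_assoc i y i]
    noncomm_ring)
  exact .inr (.inl (hσ.isStandardInvolution_of_anticommute hP hN hi hj hji))

end IsQuadraticConj

theorem IsStandardInvolution.isOfQuadraticType {σ : D → D} (h : IsStandardInvolution F σ) :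
    IsOfQuadraticType F D := by
  rcases h with h | h | h | h
  · exact .inl h.1
  · exact .inr (.inl h.1)
  · exact .inr (.inr (.inl h.1))
  · exact .inr (.inr (.inr h.1))

/-! ### Assembly. -/

theorem IsExtremal.exists_conj_eq_hermitianMatrices [FiniteDimensional F D] (hn : 2 ≤ n)
    {S : Submodule F (Matrix (Fin n) (Fin n) D)} (hS : IsExtremal S) :
    (∃ c : F, c ≠ 0 ∧ ∀ s : F, ∃ z : F, z ≠ 0 ∧ s * s + 4 * (c * c) = z * z) ∧
    ∃ σ : D → D, IsQuadraticConj F σ ∧ IsNormSquareValued F σ ∧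
      AreSimilar (S : Set (Matrix (Fin n) (Fin n) D)) (hermitianMatrices n σ) := by
  let o : Fin n := ⟨0, by omega⟩
  let p : Fin n := ⟨1, by omega⟩
  have hop : o ≠ p := by simp [o, p, Fin.ext_iff]
  obtain ⟨P, hP⟩ := hS.exists_conj_single_mem
  obtain ⟨Q, hE, hsymm⟩ := (hS.conj P).exists_conj_symm_mem hP o
  have hT := (hS.conj P).conj Q
  set T := (S.map (conjLinear F P).toLinearMap).map (conjLinear F Q).toLinearMap with hTdef
  obtain ⟨-, c, hc, -, -, hz⟩ := hT.exists_offDiagonal_mem hE hop one_ne_zero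
  have h2 : (2 : F) ≠ 0 := fun h => by
    obtain ⟨z, hz0, hz⟩ := hz 0
    apply hz0
    rw [show (4 : F) = 2 * 2 by norm_num, h] at hz
    simpa using hz.symm
  refine ⟨⟨c, hc, hz⟩, ?_⟩
  have hall : ∀ i j : Fin n, i ≠ j → Matrix.single j i 1 + Matrix.single i j 1 ∈ T := by
    intro i j hij
    by_cases hi : i = o
    · subst hi; exact hsymm j hij.symm
    by_cases hj : j = o
    · subst hj; rw [add_comm]; exact hsymm i hij
    obtain ⟨f, c, -, hf, hmem, -⟩ := hT.exists_offDiagonal_mem hE hij one_ne_zero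
    rw [one_mul] at hf
    rw [hf] at hmem
    rwa [hT.ratio_eq_one hE hi hj hij h2 (hsymm i hi) (hsymm j hj) hmem, map_one] at hmem
  obtain ⟨σ, hσ, hN, -⟩ := hT.exists_quadraticConj hE hop (hall o p hop)
  refine ⟨σ, hσ, hN, Q * P, ?_⟩
  -- Each pair of indices has its own conjugation; uniqueness identifies it with `σ`.
  rw [← hT.eq_hermitianMatrices hE h2 hσ fun i j hij a => by
    obtain ⟨τ, hτ, -, h⟩ := hT.exists_quadraticConj hE hij.ne (hall i j hij.ne)
    rw [hσ.unique hτ] at h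
    exact h a]
  rw [hTdef, Submodule.map_coe, Submodule.map_coe, Set.image_image]
  refine Set.image_congr fun M _ => ?_
  change Q.val * (P.val * M * P⁻¹.val) * Q⁻¹.val = _
  simp [mul_assoc]

end

theorem mainTheorem11 {F D : Type*} [Field F] [DivisionRing D] [Algebra F D]
    [FiniteDimensional F D] (n : ℕ) (hn : 2 ≤ n)
    (S : Submodule F (Matrix (Fin n) (Fin n) D))
    (hS : ∀ M ∈ S, IsFDiagonalisable F M)
    (hdim : Module.finrank F S = n + Module.finrank F D * n.choose 2) :
    IsSemireal F ∧ IsPythagorean F ∧ CharZero F ∧ IsOfQuadraticType F D ∧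
      ∃ σ : D → D, IsStandardInvolution F σ ∧ (∀ τ : D → D, IsStandardInvolution F τ → τ = σ) ∧
        IsNormSquareValued F σ ∧
        AreSimilar (S : Set (Matrix (Fin n) (Fin n) D)) (hermitianMatrices n σ) := by
  obtain ⟨⟨c, hc, hz⟩, σ, hσ, hN, hsim⟩ :=
    IsExtremal.exists_conj_eq_hermitianMatrices hn ⟨hS, hdim⟩
  have h2 : (2 : F) ≠ 0 := fun h => by
    obtain ⟨z, hz0, hz⟩ := hz 0
    apply hz0
    rw [show (4 : F) = 2 * 2 by norm_num, h] at hz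
    simpa using hz.symm
  have hP := IsPythagorean.of_forall_add hc h2 hz
  have hR := IsSemireal.of_forall_add hc h2 hz
  have h0 : CharZero F := inferInstance
  have hinv := hσ.isStandardInvolution hP hN
  exact ⟨hR, hP, h0, hinv.isOfQuadraticType, σ, hinv, fun τ hτ => hτ.unique hσ, hN, hsim⟩
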